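/- Let $\varepsilon>0$, let $K(x,y)=\exp\bigl(-\tfrac12\varepsilon^2(x-y)^2\bigr)$ be the Gaussian kernel on $[-1,1]\times[-1,1]$, and let $H(K)$ be its reproducing kernel Hilbert space, with norm $\|\cdot\|_K$. For a Lebesgue measurable $f\colon[-1,1]\to\mathbb R$ put $\|f\|_\infty=\sup_{x\in[-1,1]}|f(x)|$ and $\|f\|_2=\bigl(\int_{-1}^1 f(x)^2\,dx\bigr)^{1/2}$ (both may be infinite). A linear approximation is a map $A_nf=\sum_{k=1}^n f(x_k)\psi_k$ on $H(K)$, where $x_1,\dots,x_n\in[-1,1]$ are pairwise distinct points and $\psi_1,\dots,\psi_n\colon[-1,1]\to\mathbb R$ are Lebesgue measurable functions. For $p\in\{2,\infty\}$ let $$e_p(A_n)=\sup_{0\ne f\in H(K)}\frac{\|f-A_nf\|_p}{\|f\|_K},\qquad e_p^{\min}(n)=\inf_{A_n}e_p(A_n),$$ the infimum being over all linear approximations with $n$ points. For $\lambda>0$ let $$c_L(\lambda)=\frac{e^{-\frac32\lambda+2\sqrt\lambda}}{2\sqrt\pi\,\lambda^{1/4}}\Bigl(3+\sqrt{\tfrac{\pi}{e}}+\frac{2}{\sqrt\pi\,\lambda^{1/4}}+\frac{7}{16\sqrt\lambda}+\sqrt\lambda\,(2+\lambda)\Bigr),\qquad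 m_L(\lambda)=\max\Bigl\{5\lambda,\ \lambda\bigl(1+\tfrac{\lambda}{2}\bigr)^2,\ \tfrac{9}{\lambda}\Bigr\},$$ and let $$c_{1,\infty}=\sqrt{\frac{2}{1+\varepsilon^2}}\;e^{-\frac1{32}\varepsilon^4-\frac12\varepsilon^2},\qquad c_{1,2}=\frac{2\sqrt{2\pi}}{3e^3\sqrt{4+\varepsilon^2}}\;e^{-\frac1{32}\varepsilon^4-\frac12\varepsilon^2}.$$ Let $n$ be a natural number with $n\ge m_L(\varepsilon^2)$. (a) For each $p\in\{2,\infty\}$ (with $1/\infty=0$), $$c_{1,p}\Bigl(\frac{\varepsilon}{2}\Bigr)^n(n!)^{-1/2}\le e_p^{\min}(n)\le 2\sqrt{2c_L(\varepsilon^2)}\;n^{-1/8}e^{\varepsilon\sqrt n}\Bigl(\frac{\varepsilon}{2}\Bigr)^n(n!)^{-1/2},$$ and for any pairwise distinct $x_1,\dots,x_n\in[-1,1]$ there is a linear approximation $A_n$ that uses these points such that $$c_{1,p}\Bigl(\frac{\varepsilon}{2}\Bigr)^n(n!)^{-1/2}\le e_p(A_n)\le \sqrt{2c_L(\varepsilon^2)}\;n^{-1/8-1/p}e^{\varepsilon\sqrt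 n}(2\varepsilon)^n(n!)^{-1/2}.$$ (b) For $p=\infty$ the following sharper form holds, with $c_1=c_{1,\infty}$ and $c_2=2\sqrt{c_L(\varepsilon^2)}$: $$c_1\Bigl(\frac{\varepsilon}{2}\Bigr)^n(n!)^{-1/2}\le e_\infty^{\min}(n)\le c_2\,n^{-1/8}e^{\varepsilon\sqrt n}\Bigl(\frac{\varepsilon}{2}\Bigr)^n(n!)^{-1/2},$$ and for any pairwise distinct $x_1,\dots,x_n\in[-1,1]$ there is a linear approximation $A_n$ that uses these points such that $$c_1\Bigl(\frac{\varepsilon}{2}\Bigr)^n(n!)^{-1/2}\le e_\infty(A_n)\le \frac{c_2}{2}\,n^{-1/8}e^{\varepsilon\sqrt n}(2\varepsilon)^n(n!)^{-1/2}.$$ -/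

import Mathlib

open scoped ENNReal Nat

noncomputable section

namespace GaussApprox

/-- The interval `[-1, 1]`, as a type. -/
abbrev I : Type := Set.Icc (-1 : ℝ) 1

/-- Lebesgue measure on `[-1, 1]`. -/
abbrev lebesgue : MeasureTheory.Measure I :=
  MeasureTheory.Measure.comap ((↑) : I → ℝ) MeasureTheory.volume

/-! ### The Gaussian kernel and its reproducing kernel Hilbert space -/

/-- The Gaussian kernel `K(x, y) = exp(-ε² (x - y)² / 2)` on `[-1, 1] × [-1, 1]`. -/
def gaussianKernel (ε : ℝ) (x y : I) : ℝ :=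
  Real.exp (-(1 / 2) * ε ^ 2 * ((x : ℝ) - y) ^ 2)

/-- The Gaussian kernel in the form used for (vector-valued) reproducing kernel Hilbert spaces:
the entry at `(x, y)` is multiplication by `K(x, y)` on `ℝ`. -/
def gaussianMatrix (ε : ℝ) : Matrix I I (ℝ →L[ℝ] ℝ) :=
  Matrix.of fun x y => gaussianKernel ε x y • ContinuousLinearMap.id ℝ ℝ

/-- The Gaussian kernel is positive semidefinite, so that it has a reproducing kernel Hilbert
space. -/
theorem posSemidef_gaussianMatrix (ε : ℝ) : (gaussianMatrix ε).PosSemidef := by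
  have tfae := (RKHS.posSemidef_tfae (K := gaussianMatrix ε)).out 0 2
  refine tfae.mpr ⟨?_, fun v => ?_⟩
  · ext x y
    simp only [gaussianMatrix, gaussianKernel, Matrix.conjTranspose_apply, Matrix.of_apply,
      ContinuousLinearMap.star_eq_adjoint, map_smulₛₗ, ContinuousLinearMap.adjoint_id]
    simp
    exact Or.inl (by ring)
  · have key : ∀ x y : I, HasSum
        (fun k : ℕ => (Real.exp (-(1 / 2) * ε ^ 2 * (x : ℝ) ^ 2) * (ε * x) ^ k) *
          (Real.exp (-(1 / 2) * ε ^ 2 * (y : ℝ) ^ 2) * (ε * y) ^ k) / k !)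
        (gaussianKernel ε x y) := by
      intro x y
      have h := (NormedSpace.expSeries_div_hasSum_exp ((ε * x) * (ε * y) : ℝ)).mul_left
        (Real.exp (-(1 / 2) * ε ^ 2 * (x : ℝ) ^ 2) * Real.exp (-(1 / 2) * ε ^ 2 * (y : ℝ) ^ 2))
      rw [← Real.exp_eq_exp_ℝ, ← Real.exp_add, ← Real.exp_add] at h
      convert! h using 1
      · ext k
        rw [mul_pow (ε * (x : ℝ)), Real.exp_add]
        ring
      · rw [gaussianKernel]
        congr 1
        ring
    have hs := hasSum_sum (s := v.support) fun x _ => hasSum_sum (s := v.support) fun y _ =>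
      (key y x).mul_left (v x * v y)
    have h0 : ∀ k : ℕ, 0 ≤ ∑ x ∈ v.support, ∑ y ∈ v.support, v x * v y *
        ((Real.exp (-(1 / 2) * ε ^ 2 * (y : ℝ) ^ 2) * (ε * y) ^ k) *
          (Real.exp (-(1 / 2) * ε ^ 2 * (x : ℝ) ^ 2) * (ε * x) ^ k) / k !) := by
      intro k
      have : ∑ x ∈ v.support, ∑ y ∈ v.support, v x * v y *
        ((Real.exp (-(1 / 2) * ε ^ 2 * (y : ℝ) ^ 2) * (ε * y) ^ k) *
          (Real.exp (-(1 / 2) * ε ^ 2 * (x : ℝ) ^ 2) * (ε * x) ^ k) / k !) =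
          (∑ x ∈ v.support, v x * (Real.exp (-(1 / 2) * ε ^ 2 * (x : ℝ) ^ 2) * (ε * x) ^ k)) ^ 2
            / k ! := by
        rw [pow_two (∑ x ∈ v.support, _), Finset.sum_mul_sum, Finset.sum_div]
        refine Finset.sum_congr rfl fun x _ => ?_
        rw [Finset.sum_div]
        refine Finset.sum_congr rfl fun y _ => ?_
        ring
      rw [this]
      positivity
    have := hs.nonneg h0
    simp only [Finsupp.sum, gaussianMatrix, Matrix.of_apply]
    convert! this using 1
    simp
    refine Finset.sum_congr rfl fun x _ => Finset.sum_congr rfl fun y _ => ?_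
    ring

instance (ε : ℝ) : Fact (gaussianMatrix ε).PosSemidef := ⟨posSemidef_gaussianMatrix ε⟩

/-- `H(K)`, the reproducing kernel Hilbert space of the Gaussian kernel. Its elements are
coerced to functions `[-1, 1] → ℝ`, and `‖f‖` is the norm `‖f‖_K`. -/
abbrev GaussianRKHS (ε : ℝ) : Type := RKHS.OfKernel (gaussianMatrix ε)

/-! ### Norms, linear approximations and worst-case errors -/

/-- `‖f‖_∞ = sup_{x ∈ [-1, 1]} |f(x)|` (a true supremum) for `p = ∞`, and
`‖f‖_p = (∫_{-1}^1 |f(x)|^p dx)^{1/p}` for finite `p`. The value may be infinite. -/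
def pNorm (p : ℝ≥0∞) (f : I → ℝ) : ℝ≥0∞ :=
  if p = ∞ then ⨆ x, ‖f x‖ₑ else (∫⁻ x, ‖f x‖ₑ ^ p.toReal ∂lebesgue) ^ (1 / p.toReal)

/-- The data of a linear approximation `A_n f = ∑_{k=1}^n f(x_k) ψ_k`: pairwise distinct points
`x_k ∈ [-1, 1]` and Lebesgue measurable functions `ψ_k : [-1, 1] → ℝ`. -/
structure LinearApprox (n : ℕ) where
  /-- the sampling points `x_k` -/
  point : Fin n → I
  /-- the sampling points are pairwise distinct -/
  point_injective : Function.Injective point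
  /-- the functions `ψ_k` -/
  ψ : Fin n → I → ℝ
  /-- the functions `ψ_k` are Lebesgue measurable, i.e. measurable for the completed measure -/
  measurable_ψ : ∀ k, MeasureTheory.NullMeasurable (ψ k) lebesgue

/-- `A_n f = ∑_{k=1}^n f(x_k) ψ_k`. -/
def LinearApprox.apply {n : ℕ} (A : LinearApprox n) (f : I → ℝ) : I → ℝ :=
  fun x => ∑ k, f (A.point k) * A.ψ k x

/-- The worst-case error `e_p(A_n) = sup_{0 ≠ f ∈ H(K)} ‖f - A_n f‖_p / ‖f‖_K`. -/
def worstCaseError (ε : ℝ) (p : ℝ≥0∞) {n : ℕ} (A : LinearApprox n) : ℝ≥0∞ :=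
  ⨆ (f : GaussianRKHS ε) (_ : f ≠ 0), pNorm p (⇑f - A.apply ⇑f) / ‖f‖ₑ

/-- The `n`th minimal error `e_p^min(n) = inf_{A_n} e_p(A_n)`. -/
def minimalError (ε : ℝ) (p : ℝ≥0∞) (n : ℕ) : ℝ≥0∞ :=
  ⨅ A : LinearApprox n, worstCaseError ε p A

/-! ### Constants -/

/-- The function `c_L`. -/
def cL (l : ℝ) : ℝ :=
  Real.exp (-(3 / 2) * l + 2 * √l) / (2 * √Real.pi * l ^ (1 / 4 : ℝ)) *
    (3 + √(Real.pi / Real.exp 1) + 2 / (√Real.pi * l ^ (1 / 4 : ℝ)) + 7 / (16 * √l) +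
      √l * (2 + l))

/-- The function `m_L`. -/
def mL (l : ℝ) : ℝ :=
  max (5 * l) (max (l * (1 + l / 2) ^ 2) (9 / l))

/-- The constants `c_{1,∞}` and `c_{1,2}` (the latter is used only for `p = 2`), as functions of
`λ` and `φ_min`. -/
def cLower (p : ℝ≥0∞) (l φmin : ℝ) : ℝ :=
  if p = ∞ then √(2 / (1 + l)) * Real.exp (-(1 / 32) * l ^ 2) * φmin
  else 2 * √(2 * Real.pi) / (3 * Real.exp 1 ^ 3 * √(4 + l)) * Real.exp (-(1 / 32) * l ^ 2) * φmin

end GaussApprox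

end

/-!
`H(K)` embeds isometrically into `ℓ²` through `x ↦ exp (-(ε x)² / 2) ((ε x)^k / √k!)_k`, and by
translation invariance one may recentre the feature map at any point `y`.

*Upper bound.* Take for `A_n` the orthogonal projection onto the span of the kernel sections at the
nodes. The error `g = f - A_n f` vanishes at the nodes, and, recentred at `y`, it is a Gaussian
times an entire function bounded by `‖g‖ exp (|z|² / 2)`. Dividing out the zeros by Blaschke factors
of the disc of radius `√n` gives `|g(y)| ≤ (ε / √n)^n e^{n/2} |∏ k, (y - x_k)| ‖g‖`; it remains to
bound the node polynomial, for Chebyshev nodes or for arbitrary ones.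

*Lower bound.* The node polynomial `q` times `exp (-(ε x)² / 2)` lies in `H(K)` and is annihilated
by `A_n`. Its norm is a weighted `ℓ²` norm of the coefficients of `q`, which is compared with the
size of `q` on `[-1, 1]` by expanding `q` in Chebyshev polynomials of the second kind.
-/

noncomputable section

namespace GaussApprox

section FeatureMap

open InnerProductSpace

variable {𝕜 H E : Type*} [RCLike 𝕜] [NormedAddCommGroup H] [InnerProductSpace 𝕜 H]
  [NormedAddCommGroup E] [InnerProductSpace 𝕜 E]

theorem norm_linearCombination_eq_of_inner_eq {ι : Type*} {u : ι → H} {v : ι → E}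
    (huv : ∀ i j, ⟪u i, u j⟫_𝕜 = ⟪v i, v j⟫_𝕜) (c : ι →₀ 𝕜) :
    ‖Finsupp.linearCombination 𝕜 v c‖ = ‖Finsupp.linearCombination 𝕜 u c‖ := by
  simp only [norm_eq_sqrt_re_inner (𝕜 := 𝕜), Finsupp.linearCombination_apply, Finsupp.sum,
    sum_inner, inner_sum, inner_smul_left, inner_smul_right, huv]

theorem exists_linearIsometry_of_inner_eq [CompleteSpace E] {ι : Type*} {u : ι → H} {v : ι → E}
    (hu : (Submodule.span 𝕜 (Set.range u)).topologicalClosure = ⊤)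
    (huv : ∀ i j, ⟪u i, u j⟫_𝕜 = ⟪v i, v j⟫_𝕜) :
    ∃ J : H →ₗᵢ[𝕜] E, ∀ i, J (u i) = v i := by
  set e := Finsupp.linearCombination 𝕜 u
  set f := Finsupp.linearCombination 𝕜 v
  have hnorm (c : ι →₀ 𝕜) : ‖f c‖ = ‖e c‖ := norm_linearCombination_eq_of_inner_eq huv c
  have hdense : DenseRange e := by
    rwa [DenseRange, ← LinearMap.coe_range, Finsupp.range_linearCombination,
      ← Submodule.dense_iff_topologicalClosure_eq_top] at *
  have hext (c : ι →₀ 𝕜) : f.extendOfNorm e (e c) = f c :=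
    LinearMap.extendOfNorm_eq hdense ⟨1, fun c => by rw [one_mul, hnorm]⟩ c
  have hisom (w : H) : ‖f.extendOfNorm e w‖ = ‖w‖ := by
    refine hdense.induction_on w (isClosed_eq (by fun_prop) (by fun_prop)) fun c => ?_
    rw [hext, hnorm]
  refine ⟨⟨(f.extendOfNorm e).toLinearMap, hisom⟩, fun i => ?_⟩
  simpa [e, f] using hext (Finsupp.single i 1)

theorem exists_sum_inner_smul_eq_starProjection {ι : Type*} [Fintype ι] (v : ι → H)
    [(Submodule.span 𝕜 (Set.range v)).HasOrthogonalProjection] :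
    ∃ ψ : ι → H, ∀ f : H,
      ∑ k, ⟪v k, f⟫_𝕜 • ψ k = (Submodule.span 𝕜 (Set.range v)).starProjection f := by
  set S := Submodule.span 𝕜 (Set.range v)
  have : FiniteDimensional 𝕜 S := FiniteDimensional.span_of_finite 𝕜 (Set.finite_range v)
  let b := stdOrthonormalBasis 𝕜 S
  have hb (i) : ∃ c : ι → 𝕜, ∑ k, c k • v k = b i :=
    Submodule.mem_span_range_iff_exists_fun 𝕜 |>.mp (b i).2
  choose c hc using hb
  refine ⟨fun k => ∑ i, starRingEnd 𝕜 (c i k) • (b i : H), fun f => ?_⟩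
  have hinner (i) : ⟪(b i : H), f⟫_𝕜 = ∑ k, starRingEnd 𝕜 (c i k) * ⟪v k, f⟫_𝕜 := by
    simp only [← hc, sum_inner, inner_smul_left]
  rw [Submodule.starProjection_apply, b.orthogonalProjectionOnto_apply_eq_sum]
  simp only [Submodule.coe_sum, Submodule.coe_smul, hinner, Finset.smul_sum, Finset.sum_smul,
    smul_smul]
  rw [Finset.sum_comm]
  simp only [mul_comm]

variable [CompleteSpace H] {X : Type*} [RKHS 𝕜 H X 𝕜]

theorem topologicalClosure_span_kerFun_one :
    (Submodule.span 𝕜 (Set.range fun x => RKHS.kerFun H x 1)).topologicalClosure = ⊤ := by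
  rw [← top_le_iff, ← RKHS.kerFun_dense (H := H)]
  refine Submodule.topologicalClosure_mono (Submodule.span_le.mpr ?_)
  rintro _ ⟨x, c, rfl⟩
  rw [← mul_one c, ← smul_eq_mul, map_smul]
  exact Submodule.smul_mem _ _ (Submodule.subset_span ⟨x, rfl⟩)

theorem apply_eq_inner_kerFun (f : H) (x : X) : f x = ⟪RKHS.kerFun H x 1, f⟫_𝕜 := by
  simp [RKHS.kerFun_inner]

variable [CompleteSpace E] {Φ : X → E}

theorem exists_linearIsometry_kerFun (hΦ : ∀ x y, RKHS.kernel H x y 1 = ⟪Φ x, Φ y⟫_𝕜) :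
    ∃ J : H →ₗᵢ[𝕜] E, ∀ x, J (RKHS.kerFun H x 1) = Φ x := by
  refine exists_linearIsometry_of_inner_eq topologicalClosure_span_kerFun_one fun x y => ?_
  rw [← apply_eq_inner_kerFun, RKHS.kerFun_apply, hΦ]

theorem exists_norm_eq_apply_eq_inner (hΦ : ∀ x y, RKHS.kernel H x y 1 = ⟪Φ x, Φ y⟫_𝕜) (f : H) :
    ∃ a : E, ‖a‖ = ‖f‖ ∧ ∀ x, f x = ⟪Φ x, a⟫_𝕜 := by
  obtain ⟨J, hJ⟩ := exists_linearIsometry_kerFun hΦ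
  refine ⟨J f, J.norm_map f, fun x => ?_⟩
  rw [← hJ, J.inner_map_map, apply_eq_inner_kerFun]

theorem exists_norm_le_apply_eq_inner (hΦ : ∀ x y, RKHS.kernel H x y 1 = ⟪Φ x, Φ y⟫_𝕜) (a : E) :
    ∃ f : H, ‖f‖ ≤ ‖a‖ ∧ ∀ x, f x = ⟪Φ x, a⟫_𝕜 := by
  obtain ⟨J, hJ⟩ := exists_linearIsometry_kerFun hΦ
  refine ⟨J.toContinuousLinearMap.adjoint a, ?_, fun x => ?_⟩
  · refine (ContinuousLinearMap.le_opNorm _ a).trans ?_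
    rw [LinearIsometryEquiv.norm_map]
    exact mul_le_of_le_one_left (norm_nonneg a) J.norm_toContinuousLinearMap_le
  · rw [apply_eq_inner_kerFun, ContinuousLinearMap.adjoint_inner_right,
      J.coe_toContinuousLinearMap, hJ]

theorem exists_interpolation_norm_sub_le {ι : Type*} [Fintype ι] (x : ι → X) :
    ∃ ψ : ι → H, ∀ f : H, ‖f - ∑ k, f (x k) • ψ k‖ ≤ ‖f‖ ∧
      ∀ k, (f - ∑ k, f (x k) • ψ k) (x k) = 0 := by
  have : FiniteDimensional 𝕜 (Submodule.span 𝕜 (Set.range fun k => RKHS.kerFun H (x k) 1)) :=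
    FiniteDimensional.span_of_finite 𝕜 (Set.finite_range _)
  obtain ⟨ψ, hψ⟩ := exists_sum_inner_smul_eq_starProjection (𝕜 := 𝕜)
    fun k => RKHS.kerFun H (x k) 1
  simp only [← apply_eq_inner_kerFun] at hψ
  refine ⟨ψ, fun f => ?_⟩
  rw [hψ]
  constructor
  · rw [← Submodule.starProjection_orthogonal_val]
    exact Submodule.norm_starProjection_apply_le _ f
  · intro k
    rw [apply_eq_inner_kerFun, ← inner_conj_symm,
      Submodule.starProjection_inner_eq_zero _ _ (Submodule.subset_span (Set.mem_range_self k)),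
      map_zero]

end FeatureMap

section GaussianFeature

open InnerProductSpace

theorem memℓp_pow_div_sqrt_factorial (t : ℝ) :
    Memℓp (fun k : ℕ => t ^ k / √(k ! : ℝ)) 2 := by
  refine memℓp_gen ((Real.summable_pow_div_factorial (t ^ 2)).congr fun k => ?_)
  rw [ENNReal.toReal_ofNat, Real.rpow_two, Real.norm_eq_abs, sq_abs, div_pow,
    Real.sq_sqrt (by positivity), pow_right_comm]

/-- The feature map of the kernel `exp (s * t)` into `ℓ²`, given by the orthonormal basis
`t ^ k / √k !` of the (real) Fock space. -/
def fockFeature (t : ℝ) : lp (fun _ : ℕ => ℝ) 2 :=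
  ⟨fun k => t ^ k / √(k ! : ℝ), memℓp_pow_div_sqrt_factorial t⟩

theorem fockFeature_apply (t : ℝ) (k : ℕ) : fockFeature t k = t ^ k / √(k ! : ℝ) := rfl

theorem inner_fockFeature (s t : ℝ) : ⟪fockFeature s, fockFeature t⟫_ℝ = Real.exp (s * t) := by
  rw [lp.inner_eq_tsum, Real.exp_eq_exp_ℝ, NormedSpace.exp_eq_tsum_div]
  refine tsum_congr fun k => ?_
  rw [fockFeature_apply, fockFeature_apply, RCLike.inner_apply', conj_trivial, div_mul_div_comm,
    Real.mul_self_sqrt (by positivity), mul_pow]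

theorem norm_fockFeature (t : ℝ) : ‖fockFeature t‖ = Real.exp (t ^ 2 / 2) := by
  rw [norm_eq_sqrt_real_inner, inner_fockFeature, Real.sqrt_eq_iff_mul_self_eq (by positivity)
    (by positivity), ← Real.exp_add]
  ring_nf

/-- The entire function `∑ a k * z ^ k / √k !` of the Bargmann–Fock space that has the
coefficients `a`. -/
def bargmann (a : lp (fun _ : ℕ => ℝ) 2) (z : ℂ) : ℂ :=
  ∑' k, (a k : ℂ) * (z ^ k / √(k ! : ℝ))

theorem norm_bargmann_term (a : lp (fun _ : ℕ => ℝ) 2) (z : ℂ) (k : ℕ) :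
    ‖(a k : ℂ) * (z ^ k / √(k ! : ℝ))‖ = ‖a k‖ * ‖fockFeature ‖z‖ k‖ := by
  rw [norm_mul, norm_div, norm_pow, Complex.norm_real, Complex.norm_real, fockFeature_apply,
    norm_div, norm_pow, norm_norm]

theorem bargmann_ofReal (a : lp (fun _ : ℕ => ℝ) 2) (t : ℝ) :
    bargmann a t = (⟪fockFeature t, a⟫_ℝ : ℝ) := by
  rw [lp.inner_eq_tsum, Complex.ofReal_tsum, bargmann]
  simp [fockFeature_apply]

theorem differentiable_bargmann (a : lp (fun _ : ℕ => ℝ) 2) : Differentiable ℂ (bargmann a) := by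
  intro z
  refine (Complex.differentiableOn_tsum_of_summable_norm
    (lp.summable_mul (p := 2) (q := 2) (by simpa using .two_two) a (fockFeature (‖z‖ + 1)))
    (fun k => by fun_prop) Metric.isOpen_ball fun k w hw => ?_).differentiableAt
    (Metric.ball_mem_nhds z one_pos)
  have hw : ‖w‖ ≤ ‖z‖ + 1 := by
    linarith [norm_le_norm_add_norm_sub' w z, mem_ball_iff_norm.mp hw]
  rw [norm_bargmann_term, fockFeature_apply, fockFeature_apply, norm_div, norm_div, norm_pow,
    norm_pow, norm_norm, Real.norm_of_nonneg (by positivity : 0 ≤ ‖z‖ + 1)]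
  gcongr

theorem norm_bargmann_le (a : lp (fun _ : ℕ => ℝ) 2) (z : ℂ) :
    ‖bargmann a z‖ ≤ ‖a‖ * Real.exp (‖z‖ ^ 2 / 2) := by
  obtain ⟨hsum, hle⟩ :=
    lp.tsum_mul_le_mul_norm (p := 2) (q := 2) (by simpa using .two_two) a (fockFeature ‖z‖)
  simp only [← norm_bargmann_term] at hsum hle
  rw [← norm_fockFeature]
  exact (norm_tsum_le_tsum_norm hsum).trans hle

/-- The feature map of the Gaussian kernel that results from expanding `exp (ε² (x - c) (y - c))`
in a power series about the centre `c`. -/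
def gaussianFeature (ε c : ℝ) (x : I) : lp (fun _ : ℕ => ℝ) 2 :=
  Real.exp (-(ε * (x - c)) ^ 2 / 2) • fockFeature (ε * (x - c))

theorem kernel_gaussianRKHS (ε c : ℝ) (x y : I) : RKHS.kernel (GaussianRKHS ε) x y 1 =
    ⟪gaussianFeature ε c x, gaussianFeature ε c y⟫_ℝ := by
  rw [RKHS.OfKernel.kernel_ofKernel, gaussianFeature, gaussianFeature, real_inner_smul_left,
    real_inner_smul_right, inner_fockFeature, ← Real.exp_add, ← Real.exp_add]
  simp only [gaussianMatrix, gaussianKernel, Matrix.of_apply, smul_apply,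
    ContinuousLinearMap.id_apply, smul_eq_mul, mul_one]
  ring_nf

theorem exists_eq_gaussian_mul_bargmann {ε : ℝ} (f : GaussianRKHS ε) (c : ℝ) :
    ∃ a : lp (fun _ : ℕ => ℝ) 2, ‖a‖ = ‖f‖ ∧
      ∀ x, (f x : ℂ) = Real.exp (-(ε * (x - c)) ^ 2 / 2) * bargmann a (ε * (x - c) : ℝ) := by
  obtain ⟨a, ha, hfa⟩ := exists_norm_eq_apply_eq_inner (kernel_gaussianRKHS ε c) f
  refine ⟨a, ha, fun x => ?_⟩
  rw [hfa, gaussianFeature, real_inner_smul_left, bargmann_ofReal, Complex.ofReal_mul]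

theorem continuous_coe_gaussianRKHS {ε : ℝ} (f : GaussianRKHS ε) : Continuous f := by
  obtain ⟨a, -, hfa⟩ := exists_eq_gaussian_mul_bargmann f 0
  have hf : ⇑f = fun x : I => ((Real.exp (-(ε * (x - 0)) ^ 2 / 2) : ℂ) *
      bargmann a (ε * (x - 0) : ℝ)).re := by
    ext x
    rw [← hfa, Complex.ofReal_re]
  have := (differentiable_bargmann a).continuous
  rw [hf]
  fun_prop

open Polynomial Finset

/-- For `l = ε²`, the squared norm of `x ↦ exp (-l x² / 2) * x ^ j` in `H(K)`. -/
def monomialWeight (l : ℝ) (j : ℕ) : ℝ := j ! / l ^ j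

/-- For `l = ε²`, the squared norm of `x ↦ exp (-l x² / 2) * p(x)` in `H(K)`. -/
def gaussianNormSq (l : ℝ) (p : ℝ[X]) : ℝ :=
  ∑ j ∈ range (p.natDegree + 1), p.coeff j ^ 2 * monomialWeight l j

theorem exists_eq_gaussian_mul_polynomial {ε : ℝ} (hε : 0 < ε) (p : ℝ[X]) :
    ∃ f : GaussianRKHS ε, ‖f‖ ≤ √(gaussianNormSq (ε ^ 2) p) ∧
      ∀ x : I, f x = Real.exp (-(ε * x) ^ 2 / 2) * p.eval (x : ℝ) := by
  let a : lp (fun _ : ℕ => ℝ) 2 := ∑ j ∈ range (p.natDegree + 1),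
    lp.single 2 j (p.coeff j * √(j ! : ℝ) / ε ^ j)
  have ha : ‖a‖ ^ 2 = gaussianNormSq (ε ^ 2) p := by
    have h := lp.norm_sum_single (p := 2) (by norm_num)
      (fun j => p.coeff j * √(j ! : ℝ) / ε ^ j) (range (p.natDegree + 1))
    simp only [ENNReal.toReal_ofNat, Real.rpow_two, Real.norm_eq_abs, sq_abs] at h
    refine h.trans (sum_congr rfl fun j _ => ?_)
    rw [monomialWeight, div_pow, mul_pow, Real.sq_sqrt (by positivity)]
    ring
  obtain ⟨f, hf, hfa⟩ := exists_norm_le_apply_eq_inner (kernel_gaussianRKHS ε 0) a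
  refine ⟨f, hf.trans (Real.le_sqrt_of_sq_le ha.le), fun x => ?_⟩
  rw [hfa, gaussianFeature, sub_zero, real_inner_smul_left, eval_eq_sum_range, inner_sum]
  congr! 2 with j
  rw [lp.inner_single_right, fockFeature_apply, RCLike.inner_apply', conj_trivial, mul_pow]
  field_simp

end GaussianFeature

section BlaschkeBound

open Finset Polynomial

theorem norm_sq_sub_conj_mul_eq {R : ℝ} (a : ℂ) {w : ℂ} (hw : ‖w‖ = R) :
    ‖(R : ℂ) ^ 2 - starRingEnd ℂ a * w‖ = R * ‖w - a‖ := by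
  have hR : (R : ℂ) ^ 2 = starRingEnd ℂ w * w := by rw [← hw, Complex.conj_mul']
  rw [hR, ← sub_mul, ← map_sub, norm_mul, Complex.norm_conj, hw, mul_comm]

/-- The quotient of `g` by the Blaschke factor of the disc of radius `R` with zero `a`, for a zero
`a` of `g`. -/
def blaschkeQuotient (g : ℂ → ℂ) (R : ℝ) (a w : ℂ) : ℂ :=
  dslope g a w * ((R ^ 2 - starRingEnd ℂ a * w) / R)

theorem differentiable_blaschkeQuotient {g : ℂ → ℂ} (hg : Differentiable ℂ g) (R : ℝ) (a : ℂ) :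
    Differentiable ℂ (blaschkeQuotient g R a) := by
  have : Differentiable ℂ (dslope g a) := by
    rw [← differentiableOn_univ] at hg ⊢
    exact (Complex.differentiableOn_dslope Filter.univ_mem).mpr hg
  unfold blaschkeQuotient
  fun_prop

theorem norm_blaschkeQuotient_eq {g : ℂ → ℂ} {R : ℝ} {a w : ℂ} (hga : g a = 0) (haR : ‖a‖ < R)
    (hw : ‖w‖ = R) : ‖blaschkeQuotient g R a w‖ = ‖g w‖ := by
  have hR : 0 < R := (norm_nonneg a).trans_lt haR
  have hslope : (w - a) * dslope g a w = g w := by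
    simpa [hga] using sub_smul_dslope g a w
  rw [blaschkeQuotient, norm_mul, norm_div, norm_sq_sub_conj_mul_eq a hw,
    Complex.norm_of_nonneg hR.le, mul_div_cancel_left₀ _ hR.ne', mul_comm, ← norm_mul, hslope]

theorem norm_blaschkeQuotient_zero_mul {g : ℂ → ℂ} {R : ℝ} {a : ℂ} (hga : g a = 0) (hR : 0 < R) :
    ‖blaschkeQuotient g R a 0‖ * ‖a‖ = ‖g 0‖ * R := by
  have hslope : -a * dslope g a 0 = g 0 := by
    simpa [hga] using sub_smul_dslope g a 0
  have hRC : (R : ℂ) ≠ 0 := by exact_mod_cast hR.ne'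
  rw [blaschkeQuotient, mul_zero, sub_zero, pow_two, mul_div_cancel_left₀ _ hRC, norm_mul,
    Complex.norm_of_nonneg hR.le, ← hslope, norm_mul, norm_neg]
  ring

theorem norm_apply_zero_mul_pow_card_le {R M : ℝ} (hR : 0 < R) (s : Finset ℂ) {g : ℂ → ℂ}
    (hg : Differentiable ℂ g) (hs : ∀ a ∈ s, g a = 0) (hM : ∀ w, ‖w‖ = R → ‖g w‖ ≤ M) :
    ‖g 0‖ * R ^ #s ≤ (∏ a ∈ s, ‖a‖) * M := by
  induction s using Finset.induction_on generalizing g with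
  | empty =>
    simpa using Complex.norm_le_of_forall_mem_frontier_norm_le Metric.isBounded_ball
      hg.diffContOnCl (fun w hw => hM w (by simpa [frontier_ball _ hR.ne'] using hw))
      (subset_closure (Metric.mem_ball_self hR))
  | insert a s has ih =>
    have hga : g a = 0 := hs a (mem_insert_self a s)
    have hgs : ∀ b ∈ s, g b = 0 := fun b hb => hs b (mem_insert_of_mem hb)
    rw [card_insert_of_notMem has, prod_insert has, pow_succ]
    rcases lt_or_ge ‖a‖ R with haR | hRa
    · have hquot : ∀ b ∈ s, blaschkeQuotient g R a b = 0 := fun b hb => by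
        rw [blaschkeQuotient, dslope_of_ne _ (ne_of_mem_of_not_mem hb has), slope_def_field, hga,
          hgs b hb, sub_zero, zero_div, zero_mul]
      have := ih (differentiable_blaschkeQuotient hg R a) hquot
        fun w hw => (norm_blaschkeQuotient_eq hga haR hw).trans_le (hM w hw)
      calc ‖g 0‖ * (R ^ #s * R) = ‖a‖ * (‖blaschkeQuotient g R a 0‖ * R ^ #s) := by
            linear_combination -(R ^ #s) * norm_blaschkeQuotient_zero_mul hga hR
        _ ≤ ‖a‖ * ((∏ b ∈ s, ‖b‖) * M) := by gcongr
        _ = ‖a‖ * (∏ b ∈ s, ‖b‖) * M := by ring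
    · calc ‖g 0‖ * (R ^ #s * R) = R * (‖g 0‖ * R ^ #s) := by ring
        _ ≤ ‖a‖ * ((∏ b ∈ s, ‖b‖) * M) :=
            mul_le_mul hRa (ih hg hgs hM) (by positivity) (norm_nonneg a)
        _ = ‖a‖ * (∏ b ∈ s, ‖b‖) * M := by ring

/-- The node polynomial `∏ k, (X - x k)`. -/
def nodePolynomial {n : ℕ} (x : Fin n → I) : ℝ[X] :=
  Lagrange.nodal univ fun k => (x k : ℝ)

theorem abs_apply_le_of_forall_apply_eq_zero {ε R : ℝ} (hε : 0 < ε) (hR : 0 < R) {n : ℕ}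
    {x : Fin n → I} (hx : Function.Injective x) {f : GaussianRKHS ε} (hf : ∀ k, f (x k) = 0)
    (y : I) :
    |f y| ≤ (ε / R) ^ n * Real.exp (R ^ 2 / 2) * |(nodePolynomial x).eval (y : ℝ)| * ‖f‖ := by
  obtain ⟨a, ha, hfa⟩ := exists_eq_gaussian_mul_bargmann f y
  let z : Fin n → ℂ := fun k => (ε * (x k - y) : ℝ)
  have hz : Function.Injective z := fun j k hjk => hx <| Subtype.ext <| by
    simpa [z, hε.ne'] using hjk
  have hzero (k) : bargmann a (z k) = 0 := by
    have := hfa (x k)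
    rw [hf, Complex.ofReal_zero, eq_comm, mul_eq_zero] at this
    exact this.resolve_left (by exact_mod_cast (Real.exp_pos _).ne')
  have hfy : |f y| = ‖bargmann a 0‖ := by
    rw [← Real.norm_eq_abs, ← Complex.norm_real, hfa]
    simp
  have hnodal : ∏ w ∈ univ.image z, ‖w‖ = ε ^ n * |(nodePolynomial x).eval (y : ℝ)| := by
    rw [prod_image fun _ _ _ _ h => hz h, nodePolynomial, Lagrange.eval_nodal, abs_prod]
    simp [z, prod_mul_distrib, abs_of_pos hε, abs_sub_comm, -Complex.ofReal_sub,
      -Complex.ofReal_mul]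
  have := norm_apply_zero_mul_pow_card_le hR (univ.image z) (differentiable_bargmann a)
    (by simpa using hzero) fun w hw => hw ▸ norm_bargmann_le a w
  rw [hnodal, card_image_of_injective _ hz, card_univ, Fintype.card_fin, ← hfy, ha,
    ← le_div_iff₀ (by positivity)] at this
  refine this.trans_eq ?_
  rw [div_pow]
  ring

end BlaschkeBound

section UpperRate

theorem factorial_le_exp_one_mul_sqrt_mul (n : ℕ) (hn : n ≠ 0) :
    (n ! : ℝ) ≤ Real.exp 1 * √n * (n / Real.exp 1) ^ n := by
  obtain ⟨m, rfl⟩ := Nat.exists_eq_add_one_of_ne_zero hn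
  have h := Stirling.stirlingSeq'_antitone (Nat.zero_le m)
  simp only [Function.comp_apply, Nat.succ_eq_add_one, zero_add] at h
  rw [Stirling.stirlingSeq_one, Stirling.stirlingSeq, div_le_div_iff₀ (by positivity)
    (by positivity), Real.sqrt_mul two_pos.le] at h
  refine le_of_mul_le_mul_right (h.trans_eq ?_) (Real.sqrt_pos.mpr two_pos)
  ring

theorem twentyFive_mul_sq_le_exp {s : ℝ} (hs : 3 ≤ s) : 25 * s ^ 2 ≤ Real.exp (2 * s) := by
  have he := Real.exp_one_gt_d9
  calc 25 * s ^ 2 ≤ (2.7 / 2) ^ 4 * 3 ^ 2 * s ^ 2 := by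
        gcongr
        norm_num
    _ ≤ (Real.exp 1 / 2) ^ 4 * s ^ 2 * s ^ 2 := by
        gcongr
        linarith
    _ = (Real.exp 1 * (s / 2)) ^ 4 := by ring
    _ ≤ Real.exp (s / 2) ^ 4 := by
        gcongr
        exact Real.exp_one_mul_le_exp
    _ = Real.exp (2 * s) := by rw [← Real.exp_nat_mul]; ring_nf

theorem sq_le_exp_mul {s : ℝ} (hs : 0 ≤ s) : 5 / 2 * s ^ 2 ≤ Real.exp (13 / 10 * s) := by
  have he := Real.exp_one_gt_d9
  calc 5 / 2 * s ^ 2 ≤ (2.7 * (13 / 20)) ^ 2 * s ^ 2 := by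
        gcongr
        norm_num
    _ ≤ (Real.exp 1 * (13 / 20 * s)) ^ 2 := by
        rw [← mul_pow, mul_assoc]
        gcongr
        linarith
    _ ≤ Real.exp (13 / 20 * s) ^ 2 := by
        gcongr
        exact Real.exp_one_mul_le_exp
    _ = Real.exp (13 / 10 * s) := by rw [← Real.exp_nat_mul]; ring_nf

theorem ten_mul_sq_le_exp_mul {ε s : ℝ} (hε : 0 < ε) (hs : 3 ≤ s) (h : 20 * ε ^ 2 ≤ 9 * s) :
    10 * s ^ 2 ≤ Real.exp (2 * s - 3 / 2 * ε ^ 2 + 2 * ε) * (7 / 16 + 3 * ε) := by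
  rcases le_or_gt ε (4 / 3) with hε' | hε'
  · calc 10 * s ^ 2 ≤ 25 * s ^ 2 * (7 / 16) := by linarith [sq_nonneg s]
      _ ≤ Real.exp (2 * s - 3 / 2 * ε ^ 2 + 2 * ε) * (7 / 16 + 3 * ε) := by
          refine mul_le_mul ((twentyFive_mul_sq_le_exp hs).trans (Real.exp_le_exp.mpr ?_))
            (by linarith) (by norm_num) (Real.exp_pos _).le
          nlinarith
  · calc 10 * s ^ 2 = 5 / 2 * s ^ 2 * 4 := by ring
      _ ≤ Real.exp (2 * s - 3 / 2 * ε ^ 2 + 2 * ε) * (7 / 16 + 3 * ε) := by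
          refine mul_le_mul ((sq_le_exp_mul (by linarith)).trans (Real.exp_le_exp.mpr ?_))
            (by linarith) (by norm_num) (Real.exp_pos _).le
          linarith

theorem two_mul_exp_one_mul_sqrt_pi_le : 2 * Real.exp 1 * √Real.pi ≤ 10 := by
  have he : Real.exp 1 ≤ 2.72 := by linarith [Real.exp_one_lt_d9]
  have hpi : √Real.pi ≤ 1.8 :=
    Real.sqrt_le_iff.mpr ⟨by norm_num, by linarith [Real.pi_lt_d2]⟩
  calc 2 * Real.exp 1 * √Real.pi ≤ 2 * 2.72 * 1.8 := by gcongr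
    _ ≤ 10 := by norm_num

theorem le_cL_sq {ε : ℝ} (hε : 0 < ε) :
    Real.exp (-(3 / 2) * ε ^ 2 + 2 * ε) / (2 * √Real.pi * √ε) * (3 + 7 / (16 * ε)) ≤
      cL (ε ^ 2) := by
  have hroot : (ε ^ 2) ^ (1 / 4 : ℝ) = √ε := by
    rw [← Real.rpow_two, ← Real.rpow_mul hε.le, Real.sqrt_eq_rpow]
    norm_num
  rw [cL, hroot, Real.sqrt_sq hε.le]
  refine mul_le_mul_of_nonneg_left ?_ (by positivity)
  have : 0 ≤ √(Real.pi / Real.exp 1) + 2 / (√Real.pi * √ε) + ε * (2 + ε ^ 2) := by positivity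
  linarith

theorem three_le_mul_sqrt {ε : ℝ} (hε : 0 ≤ ε) {n : ℕ} (h9 : 9 ≤ ε ^ 2 * n) : 3 ≤ ε * √n := by
  refine le_of_sq_le_sq ?_ (by positivity)
  rw [mul_pow, Real.sq_sqrt n.cast_nonneg]
  linarith

theorem twenty_mul_sq_le {ε : ℝ} (hε : 0 ≤ ε) {n : ℕ} (h5 : 5 * ε ^ 2 ≤ n) :
    20 * ε ^ 2 ≤ 9 * (ε * √n) := by
  refine le_of_sq_le_sq ?_ (by positivity)
  rw [mul_pow, mul_pow 9, mul_pow ε, Real.sq_sqrt n.cast_nonneg]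
  nlinarith [sq_nonneg ε]

theorem exp_one_mul_sqrt_le {ε : ℝ} (hε : 0 < ε) {n : ℕ} (h5 : 5 * ε ^ 2 ≤ n)
    (h9 : 9 ≤ ε ^ 2 * n) :
    Real.exp 1 * √n ≤ cL (ε ^ 2) * (n : ℝ) ^ (-(1 / 4) : ℝ) * Real.exp (2 * (ε * √n)) := by
  have hn : (0 : ℝ) < n := by nlinarith
  set a := (n : ℝ) ^ (1 / 4 : ℝ) with ha
  have ha0 : 0 < a := by positivity
  have hsqrt : √n = a ^ 2 := by
    rw [ha, ← Real.rpow_natCast, ← Real.rpow_mul hn.le, Real.sqrt_eq_rpow]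
    norm_num
  set b := √ε
  have hb0 : 0 < b := by positivity
  have hb : ε = b ^ 2 := (Real.sq_sqrt hε.le).symm
  have hs3 : 3 ≤ ε * √n := three_le_mul_sqrt hε.le h9
  have hab : 1 ≤ a * b := by
    by_contra! h
    have : (a * b) ^ 2 ≤ 1 := pow_le_one₀ (by positivity) h.le
    rw [hsqrt, hb] at hs3
    linarith [mul_pow a b 2]
  have key : Real.exp 1 * a ^ 3 * (2 * √Real.pi * b) * b ^ 2 ≤
      Real.exp (2 * (ε * √n)) * Real.exp (-(3 / 2) * ε ^ 2 + 2 * ε) * (3 * ε + 7 / 16) :=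
    calc Real.exp 1 * a ^ 3 * (2 * √Real.pi * b) * b ^ 2
        = 2 * Real.exp 1 * √Real.pi * (a * b) ^ 3 := by ring
      _ ≤ 10 * (a * b) ^ 4 := by
          gcongr
          · exact two_mul_exp_one_mul_sqrt_pi_le
          · norm_num
      _ = 10 * (ε * √n) ^ 2 := by rw [hsqrt, hb]; ring
      _ ≤ _ := ten_mul_sq_le_exp_mul hε hs3 (twenty_mul_sq_le hε.le h5)
      _ = _ := by rw [← Real.exp_add]; ring_nf
  calc Real.exp 1 * √n
      = Real.exp 1 * a ^ 3 * (2 * √Real.pi * b) * b ^ 2 / (a * (2 * √Real.pi * b) * b ^ 2) := by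
        rw [hsqrt]
        field_simp
    _ ≤ Real.exp (2 * (ε * √n)) * Real.exp (-(3 / 2) * ε ^ 2 + 2 * ε) * (3 * ε + 7 / 16) /
          (a * (2 * √Real.pi * b) * b ^ 2) := by gcongr
    _ = Real.exp (-(3 / 2) * ε ^ 2 + 2 * ε) / (2 * √Real.pi * b) * (3 + 7 / (16 * ε)) *
          a⁻¹ * Real.exp (2 * (ε * √n)) := by
        rw [← hb]
        field_simp
    _ ≤ cL (ε ^ 2) * a⁻¹ * Real.exp (2 * (ε * √n)) := by
        gcongr
        exact le_cL_sq hε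
    _ = _ := by rw [ha, Real.rpow_neg hn.le]

/-- The factor by which the sup norm of the nodal polynomial is to be multiplied in the upper
bounds for the worst-case error: `√c_L(ε²) n^(-1/8) e^(ε √n) εⁿ (n!)^(-1/2)`. -/
def upperRate (ε : ℝ) (n : ℕ) : ℝ :=
  √(cL (ε ^ 2)) * (n : ℝ) ^ (-(1 / 8) : ℝ) * Real.exp (ε * √n) * ε ^ n *
    (n ! : ℝ) ^ (-(1 / 2) : ℝ)

theorem rpow_neg_half_sq {a : ℝ} (ha : 0 ≤ a) : (a ^ (-(1 / 2) : ℝ)) ^ 2 = a⁻¹ := by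
  rw [← Real.rpow_natCast, ← Real.rpow_mul ha, ← Real.rpow_neg_one]
  norm_num

theorem upperRate_sq {ε : ℝ} (hε : 0 < ε) (n : ℕ) : upperRate ε n ^ 2 =
    cL (ε ^ 2) * (n : ℝ) ^ (-(1 / 4) : ℝ) * Real.exp (2 * (ε * √n)) * (ε ^ n) ^ 2 / n ! := by
  have hcL : 0 ≤ cL (ε ^ 2) := (by positivity : (0 : ℝ) ≤ _).trans (le_cL_sq hε)
  have hroot : ((n : ℝ) ^ (-(1 / 8) : ℝ)) ^ 2 = (n : ℝ) ^ (-(1 / 4) : ℝ) := by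
    rw [← Real.rpow_natCast, ← Real.rpow_mul n.cast_nonneg]
    norm_num
  have hexp : Real.exp (ε * √n) ^ 2 = Real.exp (2 * (ε * √n)) := by
    rw [← Real.exp_nat_mul, Nat.cast_two]
  rw [upperRate, mul_pow, mul_pow, mul_pow, mul_pow, Real.sq_sqrt hcL, hroot, hexp,
    rpow_neg_half_sq (Nat.cast_nonneg _), ← div_eq_mul_inv]

theorem upperRate_nonneg {ε : ℝ} (hε : 0 ≤ ε) (n : ℕ) : 0 ≤ upperRate ε n := by
  unfold upperRate
  positivity

theorem div_sqrt_pow_mul_exp_le_upperRate {ε : ℝ} (hε : 0 < ε) {n : ℕ} (h5 : 5 * ε ^ 2 ≤ n)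
    (h9 : 9 ≤ ε ^ 2 * n) : (ε / √n) ^ n * Real.exp (√n ^ 2 / 2) ≤ upperRate ε n := by
  have hn : (0 : ℝ) < n := by nlinarith
  have hn0 : n ≠ 0 := by exact_mod_cast hn.ne'
  refine le_of_sq_le_sq ?_ (upperRate_nonneg hε.le n)
  rw [upperRate_sq hε, le_div_iff₀ (by positivity)]
  calc ((ε / √n) ^ n * Real.exp (√n ^ 2 / 2)) ^ 2 * n !
      = (ε ^ n) ^ 2 * (n ! * (n / Real.exp 1)⁻¹ ^ n) := by
        have hsq : ((√n : ℝ) ^ n) ^ 2 = (n : ℝ) ^ n := by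
          rw [pow_right_comm, Real.sq_sqrt hn.le]
        rw [mul_pow, div_pow, div_pow, hsq, ← Real.exp_nat_mul, Real.sq_sqrt hn.le, inv_div,
          div_pow, ← Real.exp_nat_mul]
        field_simp
        norm_num
    _ ≤ (ε ^ n) ^ 2 * (Real.exp 1 * √n) := by
        refine mul_le_mul_of_nonneg_left ?_ (by positivity)
        rw [inv_pow, mul_inv_le_iff₀ (by positivity)]
        exact factorial_le_exp_one_mul_sqrt_mul n hn0
    _ ≤ (ε ^ n) ^ 2 * (cL (ε ^ 2) * (n : ℝ) ^ (-(1 / 4) : ℝ) * Real.exp (2 * (ε * √n))) :=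
        mul_le_mul_of_nonneg_left (exp_one_mul_sqrt_le hε h5 h9) (by positivity)
    _ = _ := by ring

end UpperRate

section WorstCaseError

open MeasureTheory Polynomial

theorem lintegral_lebesgue (F : ℝ → ℝ≥0∞) :
    ∫⁻ x : I, F x ∂lebesgue = ∫⁻ x in Set.Icc (-1 : ℝ) 1, F x :=
  lintegral_subtype_comap measurableSet_Icc F

theorem lebesgue_univ : lebesgue Set.univ = 2 := by
  rw [← lintegral_one, lintegral_lebesgue fun _ => 1, lintegral_one, Measure.restrict_apply_univ,
    Real.volume_Icc]
  norm_num

theorem pNorm_top (f : I → ℝ) : pNorm ∞ f = ⨆ x, ‖f x‖ₑ := if_pos rfl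

theorem pNorm_of_ne_top {p : ℝ≥0∞} (hp : p ≠ ∞) (f : I → ℝ) :
    pNorm p f = (∫⁻ x, ‖f x‖ₑ ^ p.toReal ∂lebesgue) ^ (1 / p.toReal) :=
  if_neg hp

theorem pNorm_top_le {f : I → ℝ} {C : ℝ} (hC : ∀ x, |f x| ≤ C) :
    pNorm ∞ f ≤ ENNReal.ofReal C := by
  rw [pNorm_top]
  refine iSup_le fun x => ?_
  rw [Real.enorm_eq_ofReal_abs]
  exact ENNReal.ofReal_le_ofReal (hC x)

theorem pNorm_mono {f g : I → ℝ} (h : ∀ x, |f x| ≤ |g x|) (p : ℝ≥0∞) : pNorm p f ≤ pNorm p g := by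
  have he (x : I) : ‖f x‖ₑ ≤ ‖g x‖ₑ := enorm_le_iff_norm_le.mpr (h x)
  rcases eq_or_ne p ∞ with rfl | hp
  · simpa only [pNorm_top] using iSup_mono he
  · rw [pNorm_of_ne_top hp, pNorm_of_ne_top hp]
    gcongr with x
    exact he x

theorem pNorm_const_smul {p : ℝ≥0∞} (hp : p ≠ 0) (c : ℝ) (f : I → ℝ) :
    pNorm p (c • f) = ‖c‖ₑ * pNorm p f := by
  rcases eq_or_ne p ∞ with rfl | hp'
  · simp only [pNorm_top, Pi.smul_apply, smul_eq_mul, enorm_mul, ENNReal.mul_iSup]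
  · have hpos : 0 < p.toReal := ENNReal.toReal_pos hp hp'
    simp only [pNorm_of_ne_top hp', Pi.smul_apply, smul_eq_mul, enorm_mul,
      ENNReal.mul_rpow_of_nonneg _ _ hpos.le]
    rw [lintegral_const_mul' _ _ (ENNReal.rpow_ne_top_of_nonneg hpos.le enorm_ne_top),
      ENNReal.mul_rpow_of_nonneg _ _ (by positivity), ← ENNReal.rpow_mul,
      mul_one_div_cancel hpos.ne', ENNReal.rpow_one]

theorem eLpNorm_le_pNorm {p : ℝ≥0∞} (hp : p ≠ 0) (f : I → ℝ) :
    eLpNorm f p lebesgue ≤ pNorm p f := by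
  rcases eq_or_ne p ∞ with rfl | hp'
  · rw [eLpNorm_exponent_top, pNorm_top]
    exact essSup_le_of_ae_le _ (.of_forall fun x => le_iSup (fun x => ‖f x‖ₑ) x)
  · rw [eLpNorm_eq_lintegral_rpow_enorm_toReal hp hp', pNorm_of_ne_top hp']

theorem two_rpow_le_sqrt_two {a : ℝ} (ha : a ≤ 1 / 2) : (2 : ℝ≥0∞) ^ a ≤ ENNReal.ofReal √2 := by
  rw [Real.sqrt_eq_rpow, ← ENNReal.ofReal_rpow_of_pos two_pos, ENNReal.ofReal_ofNat]
  exact ENNReal.rpow_le_rpow_of_exponent_le one_le_two ha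

theorem pNorm_two_le_sqrt_two_mul_pNorm {p : ℝ≥0∞} (hp : 2 ≤ p) {f : I → ℝ} (hf : Continuous f) :
    pNorm 2 f ≤ ENNReal.ofReal √2 * pNorm p f := by
  have hp0 : p ≠ 0 := (two_pos.trans_le hp).ne'
  calc pNorm 2 f = eLpNorm f 2 lebesgue := by
        rw [eLpNorm_eq_lintegral_rpow_enorm_toReal two_ne_zero ENNReal.ofNat_ne_top,
          pNorm_of_ne_top ENNReal.ofNat_ne_top]
    _ ≤ eLpNorm f p lebesgue * lebesgue Set.univ ^ (1 / (2 : ℝ≥0∞).toReal - 1 / p.toReal) :=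
        eLpNorm_le_eLpNorm_mul_rpow_measure_univ hp hf.aestronglyMeasurable
    _ ≤ pNorm p f * ENNReal.ofReal √2 := by
        rw [lebesgue_univ]
        gcongr
        · exact eLpNorm_le_pNorm hp0 f
        · refine two_rpow_le_sqrt_two ?_
          rw [ENNReal.toReal_ofNat, sub_le_self_iff]
          positivity
    _ = ENNReal.ofReal √2 * pNorm p f := mul_comm _ _

theorem pNorm_le_sqrt_two_mul_pNorm_top {p : ℝ≥0∞} (hp : 2 ≤ p) (f : I → ℝ) :
    pNorm p f ≤ ENNReal.ofReal √2 * pNorm ∞ f := by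
  rcases eq_or_ne p ∞ with rfl | hp'
  · refine le_mul_of_one_le_left' (ENNReal.one_le_ofReal.mpr ?_)
    exact Real.one_le_sqrt.mpr one_le_two
  have hp2 : 2 ≤ p.toReal := by simpa using ENNReal.toReal_mono hp' hp
  have hpos : 0 < p.toReal := two_pos.trans_le hp2
  calc pNorm p f ≤ (∫⁻ _ : I, pNorm ∞ f ^ p.toReal ∂lebesgue) ^ (1 / p.toReal) := by
        rw [pNorm_of_ne_top hp', pNorm_top]
        gcongr with x
        exact le_iSup (fun x => ‖f x‖ₑ) x
    _ = 2 ^ (1 / p.toReal) * pNorm ∞ f := by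
        rw [lintegral_const, lebesgue_univ, ENNReal.mul_rpow_of_nonneg _ _ (by positivity),
          ← ENNReal.rpow_mul, mul_one_div_cancel hpos.ne', ENNReal.rpow_one, mul_comm]
    _ ≤ ENNReal.ofReal √2 * pNorm ∞ f := by
        gcongr
        exact two_rpow_le_sqrt_two (one_div_le_one_div_of_le two_pos hp2)

theorem pNorm_eq_ofReal_integral {p : ℝ≥0∞} (hp0 : p ≠ 0) (hp : p ≠ ∞) {F : ℝ → ℝ}
    (hF : Continuous F) :
    pNorm p (fun x : I => F x) =
      ENNReal.ofReal ((∫ x in (-1)..1, |F x| ^ p.toReal) ^ (1 / p.toReal)) := by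
  have hpos : 0 < p.toReal := ENNReal.toReal_pos hp0 hp
  have hcont : Continuous fun x => |F x| ^ p.toReal :=
    hF.abs.rpow_const fun _ => Or.inr hpos.le
  rw [pNorm_of_ne_top hp, lintegral_lebesgue fun x => ‖F x‖ₑ ^ p.toReal,
    ← ENNReal.ofReal_rpow_of_nonneg
      (intervalIntegral.integral_nonneg (by norm_num) fun _ _ => by positivity) (by positivity),
    intervalIntegral.integral_of_le (by norm_num), ← integral_Icc_eq_integral_Ioc,
    ofReal_integral_eq_lintegral_ofReal hcont.continuousOn.integrableOn_Icc
      (.of_forall fun _ => by positivity)]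
  simp only [Real.enorm_eq_ofReal_abs, ENNReal.ofReal_rpow_of_nonneg (abs_nonneg _) hpos.le]

theorem worstCaseError_le_pNorm {ε : ℝ} {p : ℝ≥0∞} (hp : p ≠ 0) {n : ℕ} {A : LinearApprox n}
    {w : I → ℝ} (h : ∀ (f : GaussianRKHS ε) (y : I), |f y - A.apply f y| ≤ ‖f‖ * |w y|) :
    worstCaseError ε p A ≤ pNorm p w := by
  refine iSup₂_le fun f _ => ENNReal.div_le_of_le_mul' ?_
  calc pNorm p (⇑f - A.apply f) ≤ pNorm p (‖f‖ • w) := pNorm_mono (fun y => by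
        simpa only [Pi.sub_apply, Pi.smul_apply, smul_eq_mul, abs_mul, abs_norm] using h f y) p
    _ = ‖f‖ₑ * pNorm p w := by rw [pNorm_const_smul hp, enorm_norm]

theorem exists_worstCaseError_le_mul_pNorm_nodePolynomial {ε : ℝ} (hε : 0 < ε) {n : ℕ}
    (h5 : 5 * ε ^ 2 ≤ n) (h9 : 9 ≤ ε ^ 2 * n) {x : Fin n → I} (hx : Function.Injective x) :
    ∃ A : LinearApprox n, A.point = x ∧ ∀ p ≠ 0, worstCaseError ε p A ≤
      ENNReal.ofReal (upperRate ε n) * pNorm p fun y => (nodePolynomial x).eval (y : ℝ) := by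
  obtain ⟨ψ, hψ⟩ := exists_interpolation_norm_sub_le (H := GaussianRKHS ε) x
  refine ⟨⟨x, hx, fun k => ψ k,
    fun k => (continuous_coe_gaussianRKHS (ψ k)).measurable.nullMeasurable⟩, rfl, fun p hp => ?_⟩
  rw [← Real.enorm_of_nonneg (upperRate_nonneg hε.le n), ← pNorm_const_smul hp]
  refine worstCaseError_le_pNorm hp fun f y => ?_
  obtain ⟨hnorm, hzero⟩ := hψ f
  have hn : (0 : ℝ) < n := pos_of_mul_pos_right (by linarith) (sq_nonneg ε)
  set g : GaussianRKHS ε := f - ∑ k, f (x k) • ψ k with hg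
  have hgy : g y = f y - ∑ k, f (x k) * ψ k y := by
    have hsum : ⇑(∑ k, f (x k) • ψ k) = ∑ k, f (x k) • ⇑(ψ k) := by
      rw [← RKHS.coeCLM_apply (𝕜 := ℝ), map_sum]
      simp only [RKHS.coeCLM_apply, RKHS.coe_smul]
    simp [hg, hsum]
  calc |f y - ∑ k, f (x k) * ψ k y| = |g y| := by rw [hgy]
    _ ≤ (ε / √n) ^ n * Real.exp (√n ^ 2 / 2) * |(nodePolynomial x).eval (y : ℝ)| * ‖g‖ :=
        abs_apply_le_of_forall_apply_eq_zero hε (Real.sqrt_pos.mpr hn) hx hzero y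
    _ ≤ upperRate ε n * |(nodePolynomial x).eval (y : ℝ)| * ‖f‖ := by
        gcongr
        · have := upperRate_nonneg hε.le n
          positivity
        · exact div_sqrt_pow_mul_exp_le_upperRate hε h5 h9
    _ = ‖f‖ * |(upperRate ε n • fun y : I => (nodePolynomial x).eval (y : ℝ)) y| := by
        rw [Pi.smul_apply, smul_eq_mul, abs_mul, abs_of_nonneg (upperRate_nonneg hε.le n), mul_comm]

end WorstCaseError

section UpperBound

open Polynomial

theorem abs_eval_nodePolynomial_le {n : ℕ} (x : Fin n → I) (y : ℝ) :
    |(nodePolynomial x).eval y| ≤ (1 + |y|) ^ n := by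
  rw [nodePolynomial, Lagrange.eval_nodal, Finset.abs_prod]
  calc ∏ k, |y - x k| ≤ ∏ _k : Fin n, (1 + |y|) :=
        Finset.prod_le_prod (fun _ _ => abs_nonneg _) fun k _ => by
          linarith [abs_sub y (x k), abs_le.mpr (x k).2]
    _ = (1 + |y|) ^ n := by simp

theorem pNorm_top_nodePolynomial_le {n : ℕ} (x : Fin n → I) :
    pNorm ∞ (fun y => (nodePolynomial x).eval (y : ℝ)) ≤ ENNReal.ofReal (2 ^ n) := by
  refine pNorm_top_le fun y => (abs_eval_nodePolynomial_le x y).trans ?_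
  gcongr
  linarith [abs_le.mpr y.2]

theorem integral_one_add_abs_rpow_le {a : ℝ} (ha : 0 ≤ a) :
    ∫ y in (-1 : ℝ)..1, (1 + |y|) ^ a ≤ 4 * 2 ^ a / (a + 1) := by
  have hint (f : ℝ → ℝ) (hf : Continuous f) :
      IntervalIntegrable (fun y => f y ^ a) MeasureTheory.volume (-1) 1 :=
    (hf.rpow_const fun _ => Or.inr ha).intervalIntegrable _ _
  have hle (y : ℝ) (hy : y ∈ Set.Icc (-1) 1) : (1 + |y|) ^ a ≤ (1 + y) ^ a + (1 - y) ^ a := by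
    have h1 : 0 ≤ (1 + y) ^ a := Real.rpow_nonneg (by linarith [hy.1]) a
    have h2 : 0 ≤ (1 - y) ^ a := Real.rpow_nonneg (by linarith [hy.2]) a
    rcases abs_choice y with h | h <;> rw [h]
    · linarith
    · rw [← sub_eq_add_neg]
      linarith
  calc ∫ y in (-1 : ℝ)..1, (1 + |y|) ^ a
      ≤ ∫ y in (-1 : ℝ)..1, ((1 + y) ^ a + (1 - y) ^ a) :=
        intervalIntegral.integral_mono_on (by norm_num) (hint _ (by fun_prop))
          ((hint _ (by fun_prop)).add (hint _ (by fun_prop))) hle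
    _ = 4 * 2 ^ a / (a + 1) := by
        rw [intervalIntegral.integral_add (hint _ (by fun_prop)) (hint _ (by fun_prop)),
          intervalIntegral.integral_comp_add_left (· ^ a),
          intervalIntegral.integral_comp_sub_left (· ^ a), add_neg_cancel, sub_self, sub_neg_eq_add,
          one_add_one_eq_two, integral_rpow (Or.inl (by linarith)), Real.zero_rpow (by linarith),
          Real.rpow_add_one two_ne_zero]
        ring

theorem rpow_integral_le_sqrt_two_mul {r : ℝ} (hr : 2 ≤ r) {n : ℕ} (hn : n ≠ 0) :
    (∫ y in (-1 : ℝ)..1, |(1 + |y|) ^ n| ^ r) ^ (1 / r) ≤ √2 * (n : ℝ) ^ (-(1 / r)) * 2 ^ n := by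
  have hpow (b : ℝ) (hb : 0 ≤ b) : (b ^ n) ^ r = b ^ (n * r) := by
    rw [Real.rpow_mul hb, Real.rpow_natCast]
  have hnr : 2 * (n : ℝ) ≤ n * r := by nlinarith
  have hint : ∫ y in (-1 : ℝ)..1, |(1 + |y|) ^ n| ^ r ≤ 2 / n * (2 ^ n) ^ r := by
    have habs (y : ℝ) : |(1 + |y|) ^ n| ^ r = (1 + |y|) ^ (n * r) := by
      rw [abs_of_nonneg (by positivity), hpow _ (by positivity)]
    simp only [habs, hpow 2 zero_le_two]
    refine (integral_one_add_abs_rpow_le (by positivity)).trans ?_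
    rw [mul_div_right_comm]
    gcongr ?_ * _
    rw [div_le_div_iff₀ (by positivity) (by positivity)]
    linarith
  calc (∫ y in (-1 : ℝ)..1, |(1 + |y|) ^ n| ^ r) ^ (1 / r)
      ≤ (2 / n * (2 ^ n) ^ r) ^ (1 / r) := by
        gcongr
        exact intervalIntegral.integral_nonneg (by norm_num) fun _ _ => by positivity
    _ = 2 ^ (1 / r) * (n : ℝ) ^ (-(1 / r)) * 2 ^ n := by
        rw [Real.mul_rpow (by positivity) (by positivity), ← Real.rpow_mul (by positivity),
          mul_one_div_cancel (by positivity), Real.rpow_one,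
          Real.div_rpow zero_le_two (by positivity), Real.rpow_neg (by positivity), div_eq_mul_inv]
    _ ≤ √2 * (n : ℝ) ^ (-(1 / r)) * 2 ^ n := by
        rw [Real.sqrt_eq_rpow]
        gcongr
        exact one_le_two

theorem pNorm_nodePolynomial_le {p : ℝ≥0∞} (hp : 2 ≤ p) {n : ℕ} (hn : n ≠ 0) (x : Fin n → I) :
    pNorm p (fun y => (nodePolynomial x).eval (y : ℝ)) ≤
      ENNReal.ofReal (√2 * (n : ℝ) ^ (-(1 / p).toReal) * 2 ^ n) := by
  rcases eq_or_ne p ∞ with rfl | hp'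
  · refine (pNorm_top_nodePolynomial_le x).trans (ENNReal.ofReal_le_ofReal ?_)
    simp
  calc pNorm p (fun y => (nodePolynomial x).eval (y : ℝ))
      ≤ pNorm p fun y => (1 + |(y : ℝ)|) ^ n :=
        pNorm_mono (fun y => (abs_eval_nodePolynomial_le x y).trans (le_abs_self _)) p
    _ = ENNReal.ofReal ((∫ y in (-1 : ℝ)..1, |(1 + |y|) ^ n| ^ p.toReal) ^ (1 / p.toReal)) :=
        pNorm_eq_ofReal_integral (two_pos.trans_le hp).ne' hp' (F := fun y => (1 + |y|) ^ n)
          (by fun_prop)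
    _ ≤ ENNReal.ofReal (√2 * (n : ℝ) ^ (-(1 / p).toReal) * 2 ^ n) := by
        rw [ENNReal.toReal_div, ENNReal.toReal_one]
        exact ENNReal.ofReal_le_ofReal <|
          rpow_integral_le_sqrt_two_mul (by simpa using ENNReal.toReal_mono hp' hp) hn

/-- The Chebyshev nodes, i.e. the zeros of the `n`th Chebyshev polynomial of the first kind. -/
def chebyshevNode (n : ℕ) (k : Fin n) : I :=
  ⟨Real.cos ((2 * k + 1) * Real.pi / (2 * n)), Real.neg_one_le_cos _, Real.cos_le_one _⟩

theorem injOn_cos_chebyshev (n : ℕ) :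
    Set.InjOn (fun k : ℕ => Real.cos ((2 * k + 1) * Real.pi / (2 * n))) (Finset.range n) :=
  (Finset.range n).nodup_map_iff_injOn.mp (Chebyshev.roots_T_real_nodup n)

theorem chebyshevNode_injective (n : ℕ) : Function.Injective (chebyshevNode n) := fun _ _ h =>
  Fin.ext (injOn_cos_chebyshev n (by simp) (by simp) (congrArg Subtype.val h))

theorem C_mul_nodePolynomial_chebyshevNode (n : ℕ) :
    C (2 ^ (n - 1)) * nodePolynomial (chebyshevNode n) = Chebyshev.T ℝ n := by
  have hroots := Chebyshev.roots_T_real n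
  have hcard : (Chebyshev.T ℝ n).roots.card = (Chebyshev.T ℝ n).natDegree := by
    rw [hroots, Chebyshev.natDegree_T, Finset.card_val,
      Finset.card_image_of_injOn (injOn_cos_chebyshev n), Finset.card_range, Int.natAbs_natCast]
  have hprod := C_leadingCoeff_mul_prod_multiset_X_sub_C hcard
  rw [hroots, Chebyshev.leadingCoeff_T, ← Finset.prod_eq_multiset_prod,
    Finset.prod_image (injOn_cos_chebyshev n), Finset.prod_range, Int.natAbs_natCast] at hprod
  exact hprod

theorem pNorm_top_nodePolynomial_chebyshevNode_le (n : ℕ) :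
    pNorm ∞ (fun y => (nodePolynomial (chebyshevNode n)).eval (y : ℝ)) ≤
      ENNReal.ofReal (2 * (1 / 2) ^ n) := by
  refine pNorm_top_le fun y => ?_
  have hT := Chebyshev.abs_eval_T_real_le_one n (abs_le.mpr y.2)
  rw [← C_mul_nodePolynomial_chebyshevNode, eval_mul, eval_C, abs_mul,
    abs_of_pos (by positivity), ← le_div_iff₀' (by positivity)] at hT
  have hpow : (2 : ℝ) ^ n ≤ 2 * 2 ^ (n - 1) := by
    rw [← pow_succ']
    exact pow_le_pow_right₀ one_le_two (by lia)
  refine hT.trans ?_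
  rwa [div_pow, one_pow, mul_one_div, div_le_div_iff₀ (by positivity) (by positivity), one_mul]

variable {ε : ℝ} {n : ℕ}

theorem minimalError_le_upperRate_mul (hε : 0 < ε) (h5 : 5 * ε ^ 2 ≤ n) (h9 : 9 ≤ ε ^ 2 * n)
    {p : ℝ≥0∞} {c : ℝ} (hp : p ≠ 0)
    (hc : pNorm p (fun y => (nodePolynomial (chebyshevNode n)).eval (y : ℝ)) ≤ ENNReal.ofReal c) :
    minimalError ε p n ≤ ENNReal.ofReal (upperRate ε n * c) := by
  obtain ⟨A, -, hA⟩ := exists_worstCaseError_le_mul_pNorm_nodePolynomial hε h5 h9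
    (chebyshevNode_injective n)
  rw [ENNReal.ofReal_mul (upperRate_nonneg hε.le n)]
  exact (iInf_le _ A).trans ((hA p hp).trans (by gcongr))

theorem minimalError_top_le (hε : 0 < ε) (h5 : 5 * ε ^ 2 ≤ n) (h9 : 9 ≤ ε ^ 2 * n) :
    minimalError ε ∞ n ≤ ENNReal.ofReal (2 * √(cL (ε ^ 2)) * (n : ℝ) ^ (-(1 / 8) : ℝ) *
      Real.exp (ε * √n) * (ε / 2) ^ n * (n ! : ℝ) ^ (-(1 / 2) : ℝ)) := by
  convert! minimalError_le_upperRate_mul hε h5 h9 ENNReal.top_ne_zero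
    (pNorm_top_nodePolynomial_chebyshevNode_le n) using 2
  rw [upperRate, div_pow, div_pow, one_pow]
  ring

theorem minimalError_le (hε : 0 < ε) (h5 : 5 * ε ^ 2 ≤ n) (h9 : 9 ≤ ε ^ 2 * n) {p : ℝ≥0∞}
    (hp : 2 ≤ p) :
    minimalError ε p n ≤ ENNReal.ofReal (2 * √(2 * cL (ε ^ 2)) * (n : ℝ) ^ (-(1 / 8) : ℝ) *
      Real.exp (ε * √n) * (ε / 2) ^ n * (n ! : ℝ) ^ (-(1 / 2) : ℝ)) := by
  have hc : pNorm p (fun y => (nodePolynomial (chebyshevNode n)).eval (y : ℝ)) ≤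
      ENNReal.ofReal (√2 * (2 * (1 / 2) ^ n)) := by
    rw [ENNReal.ofReal_mul (Real.sqrt_nonneg 2)]
    refine (pNorm_le_sqrt_two_mul_pNorm_top hp _).trans ?_
    gcongr
    exact pNorm_top_nodePolynomial_chebyshevNode_le n
  convert! minimalError_le_upperRate_mul hε h5 h9 (two_pos.trans_le hp).ne' hc using 2
  rw [upperRate, Real.sqrt_mul zero_le_two, div_pow, div_pow, one_pow]
  ring

theorem exists_worstCaseError_le (hε : 0 < ε) (h5 : 5 * ε ^ 2 ≤ n) (h9 : 9 ≤ ε ^ 2 * n)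
    {x : Fin n → I} (hx : Function.Injective x) :
    ∃ A : LinearApprox n, A.point = x ∧
      worstCaseError ε ∞ A ≤ ENNReal.ofReal (√(cL (ε ^ 2)) * (n : ℝ) ^ (-(1 / 8) : ℝ) *
        Real.exp (ε * √n) * (2 * ε) ^ n * (n ! : ℝ) ^ (-(1 / 2) : ℝ)) ∧
      ∀ p, 2 ≤ p → worstCaseError ε p A ≤ ENNReal.ofReal (√(2 * cL (ε ^ 2)) *
        (n : ℝ) ^ (-(1 / 8) - (1 / p).toReal : ℝ) * Real.exp (ε * √n) * (2 * ε) ^ n *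
        (n ! : ℝ) ^ (-(1 / 2) : ℝ)) := by
  obtain ⟨A, hAx, hA⟩ := exists_worstCaseError_le_mul_pNorm_nodePolynomial hε h5 h9 hx
  have hn : (0 : ℝ) < n := pos_of_mul_pos_right (by linarith) (sq_nonneg ε)
  have hU := upperRate_nonneg hε.le n
  refine ⟨A, hAx, (hA ∞ ENNReal.top_ne_zero).trans ?_, fun p hp =>
    (hA p (two_pos.trans_le hp).ne').trans ?_⟩
  · calc _ ≤ ENNReal.ofReal (upperRate ε n) * ENNReal.ofReal (2 ^ n) := by
          gcongr
          exact pNorm_top_nodePolynomial_le x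
      _ = _ := by
          rw [← ENNReal.ofReal_mul hU, upperRate, mul_pow]
          ring_nf
  · calc _ ≤ ENNReal.ofReal (upperRate ε n) *
            ENNReal.ofReal (√2 * (n : ℝ) ^ (-(1 / p).toReal) * 2 ^ n) := by
          gcongr
          exact pNorm_nodePolynomial_le hp (by exact_mod_cast hn.ne') x
      _ = _ := by
          rw [← ENNReal.ofReal_mul hU, upperRate, mul_pow, Real.sqrt_mul zero_le_two,
            sub_eq_add_neg, Real.rpow_add hn]
          ring_nf

end UpperBound

section ChebyshevU

open Finset Polynomial

theorem exists_eq_sum_smul_chebyshevU {p : ℝ[X]} {n : ℕ} (hp : p.natDegree ≤ n) :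
    ∃ b : ℕ → ℝ, p = ∑ k ∈ range (n + 1), b k • Chebyshev.U ℝ k := by
  let S : Polynomial.Sequence ℝ := ⟨fun k => Chebyshev.U ℝ k, Chebyshev.degree_U_natCast ℝ⟩
  have hspan : p ∈ Submodule.span ℝ (S '' (range (n + 1) : Finset ℕ)) := by
    have hS := S.span_degreeLT (m := n + 1) fun k _ =>
      (leadingCoeff_ne_zero.mpr (S.ne_zero k)).isUnit
    rw [coe_range, hS, mem_degreeLT, degree_lt_iff_coeff_zero]
    exact fun k hk => coeff_eq_zero_of_natDegree_lt (by lia)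
  rw [Submodule.mem_span_image_finset_iff_exists_fun'] at hspan
  obtain ⟨b, hb⟩ := hspan
  exact ⟨b, hb.symm⟩

theorem integral_cos_int_mul {m : ℤ} (hm : m ≠ 0) :
    ∫ θ in (0 : ℝ)..Real.pi, Real.cos (m * θ) = 0 := by
  rw [intervalIntegral.integral_comp_mul_left _ (Int.cast_ne_zero.mpr hm), integral_cos]
  simp [Real.sin_int_mul_pi]

theorem integral_chebyshevU_mul_chebyshevU (j k : ℕ) :
    ∫ θ in (0 : ℝ)..Real.pi, (Chebyshev.U ℝ j).eval (Real.cos θ) * Real.sin θ *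
      ((Chebyshev.U ℝ k).eval (Real.cos θ) * Real.sin θ) = if j = k then Real.pi / 2 else 0 := by
  have hprod (θ : ℝ) : (Chebyshev.U ℝ j).eval (Real.cos θ) * Real.sin θ *
      ((Chebyshev.U ℝ k).eval (Real.cos θ) * Real.sin θ) =
      1 / 2 * (Real.cos ((j - k : ℤ) * θ) - Real.cos ((j + k + 2 : ℤ) * θ)) := by
    have hsub : ((j - k : ℤ) : ℝ) * θ = (j + 1) * θ - (k + 1) * θ := by push_cast; ring
    have hadd : ((j + k + 2 : ℤ) : ℝ) * θ = (j + 1) * θ + (k + 1) * θ := by push_cast; ring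
    rw [Chebyshev.U_real_cos, Chebyshev.U_real_cos, hsub, hadd, Real.cos_sub, Real.cos_add]
    push_cast
    ring
  simp only [hprod]
  rw [intervalIntegral.integral_const_mul, intervalIntegral.integral_sub
    (Continuous.intervalIntegrable (by fun_prop) _ _)
    (Continuous.intervalIntegrable (by fun_prop) _ _), integral_cos_int_mul (m := j + k + 2)
    (by lia)]
  split_ifs with h
  · simp only [h, sub_self, Int.cast_zero, zero_mul, Real.cos_zero,
      intervalIntegral.integral_const, smul_eq_mul]
    ring
  · rw [integral_cos_int_mul (by lia)]
    ring

/-- The square of the norm of `p` in `L²([-1, 1], (2 / π) √(1 - x²) dx)`, the space in which the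
Chebyshev polynomials of the second kind are orthonormal, after the substitution `x = cos θ`. -/
def chebyshevUNormSq (p : ℝ[X]) : ℝ :=
  2 / Real.pi * ∫ θ in (0 : ℝ)..Real.pi, (p.eval (Real.cos θ) * Real.sin θ) ^ 2

theorem chebyshevUNormSq_sum (s : Finset ℕ) (b : ℕ → ℝ) :
    chebyshevUNormSq (∑ k ∈ s, b k • Chebyshev.U ℝ k) = ∑ k ∈ s, b k ^ 2 := by
  have hsq (θ : ℝ) : ((∑ k ∈ s, b k • Chebyshev.U ℝ k).eval (Real.cos θ) * Real.sin θ) ^ 2 =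
      ∑ j ∈ s, ∑ k ∈ s, b j * b k * ((Chebyshev.U ℝ j).eval (Real.cos θ) * Real.sin θ *
        ((Chebyshev.U ℝ k).eval (Real.cos θ) * Real.sin θ)) := by
    rw [eval_finsetSum, sum_mul, sq, sum_mul_sum]
    simp only [eval_smul, smul_eq_mul]
    exact sum_congr rfl fun j _ => sum_congr rfl fun k _ => by ring
  have hint : ∫ θ in (0 : ℝ)..Real.pi,
      ((∑ k ∈ s, b k • Chebyshev.U ℝ k).eval (Real.cos θ) * Real.sin θ) ^ 2 =
      ∑ k ∈ s, b k ^ 2 * (Real.pi / 2) := by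
    simp only [hsq]
    rw [intervalIntegral.integral_finsetSum fun j _ =>
      Continuous.intervalIntegrable (by fun_prop) _ _]
    refine sum_congr rfl fun j hj => ?_
    rw [intervalIntegral.integral_finsetSum fun k _ =>
      Continuous.intervalIntegrable (by fun_prop) _ _]
    simp only [intervalIntegral.integral_const_mul, integral_chebyshevU_mul_chebyshevU, mul_ite,
      mul_zero, sum_ite_eq, if_pos hj, sq]
  rw [chebyshevUNormSq, hint, ← sum_mul]
  field_simp

theorem chebyshevUNormSq_nonneg (p : ℝ[X]) : 0 ≤ chebyshevUNormSq p :=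
  mul_nonneg (by positivity)
    (intervalIntegral.integral_nonneg Real.pi_pos.le fun _ _ => sq_nonneg _)

theorem chebyshevUNormSq_le_sq {p : ℝ[X]} {M : ℝ}
    (hM : ∀ x ∈ Set.Icc (-1 : ℝ) 1, |p.eval x| ≤ M) : chebyshevUNormSq p ≤ M ^ 2 := by
  have hint : ∫ θ in (0 : ℝ)..Real.pi, (p.eval (Real.cos θ) * Real.sin θ) ^ 2 ≤
      ∫ θ in (0 : ℝ)..Real.pi, M ^ 2 * Real.sin θ ^ 2 := by
    refine intervalIntegral.integral_mono_on Real.pi_pos.le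
      (Continuous.intervalIntegrable (by fun_prop) _ _)
      (Continuous.intervalIntegrable (by fun_prop) _ _) fun θ _ => ?_
    rw [mul_pow, ← sq_abs (p.eval _)]
    gcongr
    exact hM _ (Real.cos_mem_Icc θ)
  calc chebyshevUNormSq p
      ≤ 2 / Real.pi * ∫ θ in (0 : ℝ)..Real.pi, M ^ 2 * Real.sin θ ^ 2 :=
        mul_le_mul_of_nonneg_left hint (by positivity)
    _ = M ^ 2 := by
        rw [intervalIntegral.integral_const_mul, integral_sin_sq, Real.sin_zero, Real.sin_pi]
        field_simp
        ring

theorem chebyshevUNormSq_le_integral (p : ℝ[X]) :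
    chebyshevUNormSq p ≤ 2 / Real.pi * ∫ x in (-1 : ℝ)..1, p.eval x ^ 2 := by
  have hsubst : ∫ θ in (0 : ℝ)..Real.pi, p.eval (Real.cos θ) ^ 2 * Real.sin θ =
      ∫ x in (-1 : ℝ)..1, p.eval x ^ 2 := by
    have h := intervalIntegral.integral_comp_mul_deriv (a := 0) (b := Real.pi)
      (f := Real.cos) (f' := fun θ => -Real.sin θ) (g := fun x => p.eval x ^ 2)
      (fun θ _ => Real.hasDerivAt_cos θ) (by fun_prop) (by fun_prop)
    simpa only [Function.comp_apply, mul_neg, intervalIntegral.integral_neg, Real.cos_zero,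
      Real.cos_pi, intervalIntegral.integral_symm (-1) 1, neg_inj] using h
  rw [chebyshevUNormSq, ← hsubst]
  refine mul_le_mul_of_nonneg_left (intervalIntegral.integral_mono_on Real.pi_pos.le
    (Continuous.intervalIntegrable (by fun_prop) _ _)
    (Continuous.intervalIntegrable (by fun_prop) _ _) fun θ hθ => ?_) (by positivity)
  have hsin : Real.sin θ ^ 2 ≤ Real.sin θ :=
    pow_le_of_le_one (Real.sin_nonneg_of_nonneg_of_le_pi hθ.1 hθ.2) (Real.sin_le_one θ) two_ne_zero
  rw [mul_pow]
  gcongr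

theorem sum_coeff_sq_mul_le {p : ℝ[X]} {n : ℕ} (hp : p.natDegree ≤ n) (s : Finset ℕ) {w : ℕ → ℝ}
    (hw : ∀ j, 0 ≤ w j) :
    ∑ j ∈ s, p.coeff j ^ 2 * w j ≤
      chebyshevUNormSq p * ∑ k ∈ range (n + 1), ∑ j ∈ s, (Chebyshev.U ℝ k).coeff j ^ 2 * w j := by
  obtain ⟨b, rfl⟩ := exists_eq_sum_smul_chebyshevU hp
  rw [sum_comm, chebyshevUNormSq_sum, mul_sum]
  refine sum_le_sum fun j _ => ?_
  rw [← sum_mul, ← mul_assoc]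
  refine mul_le_mul_of_nonneg_right ?_ (hw j)
  simpa only [finsetSum_coeff, coeff_smul, smul_eq_mul] using sum_mul_sq_le_sq_mul_sq _ _ _

theorem coeff_succ_chebyshevU_add_two (k j : ℕ) :
    (Chebyshev.U ℝ (k + 2 : ℕ)).coeff (j + 1) =
      2 * (Chebyshev.U ℝ (k + 1 : ℕ)).coeff j - (Chebyshev.U ℝ k).coeff (j + 1) := by
  push_cast
  rw [Chebyshev.U_add_two, coeff_sub, mul_assoc, ← C_ofNat, coeff_C_mul, coeff_X_mul]

theorem coeff_zero_chebyshevU_add_two (k : ℕ) :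
    (Chebyshev.U ℝ (k + 2 : ℕ)).coeff 0 = -(Chebyshev.U ℝ k).coeff 0 := by
  push_cast
  rw [Chebyshev.U_add_two, coeff_sub, mul_assoc, ← C_ofNat, coeff_C_mul, coeff_X_mul_zero, mul_zero,
    zero_sub]

theorem coeff_chebyshevU_of_lt {k j : ℕ} (h : k < j) : (Chebyshev.U ℝ k).coeff j = 0 :=
  coeff_eq_zero_of_natDegree_lt (by rwa [Chebyshev.natDegree_U_natCast])

theorem coeff_chebyshevU_self (k : ℕ) : (Chebyshev.U ℝ k).coeff k = 2 ^ k := by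
  simpa only [leadingCoeff, Chebyshev.natDegree_U_natCast] using
    Chebyshev.leadingCoeff_U_natCast ℝ k

theorem coeff_chebyshevU_add_two_mul (j m : ℕ) :
    (Chebyshev.U ℝ (j + 2 * m : ℕ)).coeff j = (-1) ^ m * 2 ^ j * (j + m).choose m := by
  induction m generalizing j with
  | zero => simpa using coeff_chebyshevU_self j
  | succ m ihm =>
    induction j with
    | zero =>
      rw [show 0 + 2 * (m + 1) = 0 + 2 * m + 2 by ring, coeff_zero_chebyshevU_add_two, ihm]
      simp [pow_succ]
    | succ j ihj =>
      rw [show j + 1 + 2 * (m + 1) = j + 1 + 2 * m + 2 by ring, coeff_succ_chebyshevU_add_two, ihm,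
        show j + 1 + 2 * m + 1 = j + 2 * (m + 1) by ring, ihj,
        show j + 1 + (m + 1) = j + 1 + m + 1 by ring, Nat.choose_succ_succ (j + 1 + m) m,
        show j + (m + 1) = j + 1 + m by ring]
      push_cast
      ring

theorem coeff_chebyshevU_add_two_mul_add_one (j m : ℕ) :
    (Chebyshev.U ℝ (j + 2 * m + 1 : ℕ)).coeff j = 0 := by
  induction m generalizing j with
  | zero =>
    induction j with
    | zero => simp
    | succ j ihj =>
      rw [show j + 1 + 2 * 0 + 1 = j + 2 by ring, coeff_succ_chebyshevU_add_two,
        coeff_chebyshevU_of_lt j.lt_succ_self, sub_zero]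
      exact mul_eq_zero_of_right 2 ihj
  | succ m ihm =>
    induction j with
    | zero =>
      rw [show 0 + 2 * (m + 1) + 1 = 0 + 2 * m + 1 + 2 by ring, coeff_zero_chebyshevU_add_two, ihm,
        neg_zero]
    | succ j ihj =>
      rw [show j + 1 + 2 * (m + 1) + 1 = j + 1 + 2 * m + 1 + 2 by ring,
        coeff_succ_chebyshevU_add_two, ihm,
        show j + 1 + 2 * m + 1 + 1 = j + 2 * (m + 1) + 1 by ring, ihj]
      ring

end ChebyshevU

section GaussianNorm

open Finset Polynomial

theorem monomialWeight_nonneg {l : ℝ} (hl : 0 ≤ l) (j : ℕ) : 0 ≤ monomialWeight l j := by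
  unfold monomialWeight
  positivity

theorem gaussianNormSq_nonneg {l : ℝ} (hl : 0 ≤ l) (p : ℝ[X]) : 0 ≤ gaussianNormSq l p :=
  sum_nonneg fun j _ => mul_nonneg (sq_nonneg _) (monomialWeight_nonneg hl j)

theorem gaussianNormSq_of_natDegree_lt {l : ℝ} {p : ℝ[X]} {n : ℕ} (hp : p.natDegree < n) :
    gaussianNormSq l p = ∑ j ∈ range n, p.coeff j ^ 2 * monomialWeight l j := by
  refine sum_subset (range_mono hp) fun j _ hj => ?_
  rw [coeff_eq_zero_of_natDegree_lt (by simpa using hj)]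
  ring

theorem choose_sq_mul_factorial_mul_factorial_le (j m : ℕ) :
    (j + m).choose m ^ 2 * j ! * m ! ≤ (j + 2 * m)! := by
  calc (j + m).choose m ^ 2 * j ! * m ! = (j + m).choose m * (j + m)! := by
        rw [← Nat.add_choose_mul_factorial_mul_factorial j m, ← Nat.choose_symm_add]
        ring
    _ ≤ (j + 2 * m).choose m * (j + m)! := by
        gcongr
        lia
    _ ≤ (j + 2 * m).choose m * (j + m)! * m ! := Nat.le_mul_of_pos_right _ m.factorial_pos
    _ = (j + 2 * m)! := by
        rw [two_mul, ← add_assoc, ← Nat.add_choose_mul_factorial_mul_factorial (j + m) m]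

theorem coeff_chebyshevU_sq_mul_monomialWeight_le {l : ℝ} (hl : 0 < l) (j m : ℕ) :
    (Chebyshev.U ℝ (j + 2 * m : ℕ)).coeff j ^ 2 * monomialWeight l j ≤
      4 ^ (j + 2 * m) * monomialWeight l (j + 2 * m) * ((l ^ 2 / 16) ^ m / m !) := by
  have hfac : ((j + m).choose m : ℝ) ^ 2 * j ! * m ! ≤ (j + 2 * m)! :=
    mod_cast choose_sq_mul_factorial_mul_factorial_le j m
  calc (Chebyshev.U ℝ (j + 2 * m : ℕ)).coeff j ^ 2 * monomialWeight l j
      = 4 ^ j / l ^ j / m ! * (((j + m).choose m : ℝ) ^ 2 * j ! * m !) := by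
        rw [coeff_chebyshevU_add_two_mul, monomialWeight, mul_pow, mul_pow, ← pow_mul, ← pow_mul,
          mul_comm m, mul_comm j, pow_mul, pow_mul]
        field_simp
        norm_num [mul_comm]
    _ ≤ 4 ^ j / l ^ j / m ! * (j + 2 * m)! := by gcongr
    _ = 4 ^ (j + 2 * m) * monomialWeight l (j + 2 * m) * ((l ^ 2 / 16) ^ m / m !) := by
        rw [monomialWeight, div_pow, pow_add, pow_add, pow_mul, pow_mul]
        field_simp
        norm_num

theorem gaussianNormSq_chebyshevU_le {l : ℝ} (hl : 0 < l) (k : ℕ) :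
    gaussianNormSq l (Chebyshev.U ℝ k) ≤
      4 ^ k * monomialWeight l k * Real.exp (l ^ 2 / 16) := by
  have hparity : ∑ m ∈ range (k / 2 + 1),
      (Chebyshev.U ℝ k).coeff (k - 2 * m) ^ 2 * monomialWeight l (k - 2 * m) =
      gaussianNormSq l (Chebyshev.U ℝ k) := by
    rw [gaussianNormSq, Chebyshev.natDegree_U_natCast]
    refine sum_of_injOn (fun m => k - 2 * m) (fun i hi j hj h => ?_) (fun m _ => ?_)
      (fun j hj hj' => ?_) fun _ _ => rfl
    · simp only [coe_range, Set.mem_Iio] at hi hj h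
      lia
    · simp only [coe_range, Set.mem_Iio]
      lia
    · obtain ⟨m, rfl | rfl⟩ : ∃ m, k = j + 2 * m ∨ k = j + 2 * m + 1 :=
        ⟨(k - j) / 2, by rw [mem_range] at hj; lia⟩
      · exact (hj' ⟨m, by simp only [coe_range, Set.mem_Iio]; lia, by simp⟩).elim
      · rw [coeff_chebyshevU_add_two_mul_add_one]
        ring
  calc gaussianNormSq l (Chebyshev.U ℝ k)
      ≤ ∑ m ∈ range (k / 2 + 1), 4 ^ k * monomialWeight l k * ((l ^ 2 / 16) ^ m / m !) := by
        rw [← hparity]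
        refine sum_le_sum fun m hm => ?_
        have h := coeff_chebyshevU_sq_mul_monomialWeight_le hl (k - 2 * m) m
        rwa [Nat.sub_add_cancel (by rw [mem_range] at hm; lia)] at h
    _ ≤ 4 ^ k * monomialWeight l k * Real.exp (l ^ 2 / 16) := by
        rw [← mul_sum]
        have := monomialWeight_nonneg hl.le k
        gcongr
        exact Real.sum_le_exp_of_nonneg (by positivity) _

theorem add_one_pow_le_exp_mul_descFactorial {m d : ℕ} (h : d ≤ m) :
    ((m : ℝ) + 1) ^ d ≤ Real.exp 1 ^ d * m.descFactorial d := by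
  induction d generalizing m with
  | zero => simp
  | succ d ih =>
    obtain ⟨m, rfl⟩ := Nat.exists_eq_add_of_lt (Nat.zero_lt_of_lt h)
    simp only [zero_add] at h ⊢
    have hexp : (1 + ((m + 1 : ℕ) : ℝ)⁻¹) ^ (d + 1) ≤ Real.exp 1 :=
      (pow_le_pow_right₀ (le_add_of_nonneg_right (by positivity)) h).trans
        Real.one_add_inv_pow_le_exp
    calc (((m + 1 : ℕ) : ℝ) + 1) ^ (d + 1)
        = (1 + ((m + 1 : ℕ) : ℝ)⁻¹) ^ (d + 1) * ((m + 1) * (m + 1) ^ d) := by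
          rw [← pow_succ', ← mul_pow]
          push_cast
          field_simp
      _ ≤ Real.exp 1 * ((m + 1) * (Real.exp 1 ^ d * m.descFactorial d)) := by
          have := ih (Nat.le_of_succ_le_succ h)
          gcongr
      _ = Real.exp 1 ^ (d + 1) * (m + 1).descFactorial (d + 1) := by
          rw [Nat.succ_descFactorial_succ]
          push_cast
          ring

theorem four_pow_mul_monomialWeight_le {l : ℝ} (hl : 0 < l) {k m : ℕ} (hkm : k ≤ m)
    (hlm : l ≤ m + 1) : 4 ^ k * monomialWeight l k ≤ 4 ^ m * monomialWeight l m := by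
  obtain ⟨d, rfl⟩ := Nat.exists_eq_add_of_le hkm
  have hexp : l / 4 ≤ ((k + d : ℕ) + 1) / Real.exp 1 := by
    gcongr
    linarith [Real.exp_one_lt_d9]
  have hdesc : (l / 4) ^ d ≤ (k + d).descFactorial d := by
    refine (pow_le_pow_left₀ (by positivity) hexp d).trans ?_
    rw [div_pow, div_le_iff₀' (by positivity)]
    exact add_one_pow_le_exp_mul_descFactorial (Nat.le_add_left d k)
  calc 4 ^ k * monomialWeight l k = 4 ^ (k + d) / l ^ (k + d) * (k ! * (l / 4) ^ d) := by
        rw [monomialWeight, div_pow, pow_add, pow_add]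
        field_simp
    _ ≤ 4 ^ (k + d) / l ^ (k + d) * (k ! * (k + d).descFactorial d) := by gcongr
    _ = 4 ^ (k + d) * monomialWeight l (k + d) := by
        have h := Nat.factorial_mul_descFactorial (Nat.le_add_left d k)
        rw [Nat.add_sub_cancel] at h
        rw [monomialWeight, ← h]
        push_cast
        ring

theorem sum_four_pow_mul_monomialWeight_le {l : ℝ} (hl : 0 < l) {n : ℕ} (hn : l ≤ n) :
    ∑ k ∈ range n, 4 ^ k * monomialWeight l k ≤ l / 4 * (4 ^ n * monomialWeight l n) := by
  obtain ⟨m, rfl⟩ := Nat.exists_eq_succ_of_ne_zero (Nat.cast_pos.mp (hl.trans_le hn)).ne'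
  calc ∑ k ∈ range (m + 1), 4 ^ k * monomialWeight l k
      ≤ ∑ _k ∈ range (m + 1), 4 ^ m * monomialWeight l m :=
        sum_le_sum fun k hk =>
          four_pow_mul_monomialWeight_le hl (by rw [mem_range] at hk; lia) (mod_cast hn)
    _ = l / 4 * (4 ^ (m + 1) * monomialWeight l (m + 1)) := by
        rw [sum_const, card_range, nsmul_eq_mul, monomialWeight, monomialWeight,
          Nat.factorial_succ, pow_succ, pow_succ]
        push_cast
        field_simp

theorem sum_gaussianNormSq_chebyshevU_le {l : ℝ} (hl : 0 < l) {n : ℕ} (hn : l ≤ n) :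
    ∑ k ∈ range (n + 1), gaussianNormSq l (Chebyshev.U ℝ k) ≤
      4 ^ n * monomialWeight l n * ((1 + l / 4) * Real.exp (l ^ 2 / 16)) := by
  calc ∑ k ∈ range (n + 1), gaussianNormSq l (Chebyshev.U ℝ k)
      ≤ ∑ k ∈ range (n + 1), 4 ^ k * monomialWeight l k * Real.exp (l ^ 2 / 16) :=
        sum_le_sum fun k _ => gaussianNormSq_chebyshevU_le hl k
    _ ≤ (l / 4 * (4 ^ n * monomialWeight l n) + 4 ^ n * monomialWeight l n) *
          Real.exp (l ^ 2 / 16) := by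
        rw [← sum_mul, sum_range_succ]
        gcongr
        exact sum_four_pow_mul_monomialWeight_le hl hn
    _ = _ := by ring

theorem gaussianNormSq_le_chebyshevUNormSq {l : ℝ} (hl : 0 < l) {n : ℕ} (hn : l ≤ n) {p : ℝ[X]}
    (hp : p.natDegree ≤ n) :
    gaussianNormSq l p ≤ chebyshevUNormSq p *
      (4 ^ n * monomialWeight l n * ((1 + l / 4) * Real.exp (l ^ 2 / 16))) := by
  rw [gaussianNormSq_of_natDegree_lt (Nat.lt_succ_iff.mpr hp)]
  refine (sum_coeff_sq_mul_le hp _ (monomialWeight_nonneg hl.le)).trans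
    (mul_le_mul_of_nonneg_left ?_ (chebyshevUNormSq_nonneg p))
  refine le_trans (sum_le_sum fun k hk => ?_) (sum_gaussianNormSq_chebyshevU_le hl hn)
  rw [gaussianNormSq_of_natDegree_lt (n := n + 1) (by simpa [Nat.lt_succ_iff] using hk)]

theorem gaussianNormSq_le_leadingCoeff_add {l : ℝ} (hl : 0 < l) {n : ℕ} (hn : l ≤ n) {p : ℝ[X]}
    (hp : p.natDegree ≤ n) :
    gaussianNormSq l p ≤ p.coeff n ^ 2 * monomialWeight l n + chebyshevUNormSq p *
      (4 ^ n * monomialWeight l n * ((1 + l / 4) * Real.exp (l ^ 2 / 16) - 1)) := by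
  have htop : gaussianNormSq l (Chebyshev.U ℝ n) =
      ∑ j ∈ range n, (Chebyshev.U ℝ n).coeff j ^ 2 * monomialWeight l j +
        4 ^ n * monomialWeight l n := by
    rw [gaussianNormSq, Chebyshev.natDegree_U_natCast, sum_range_succ, coeff_chebyshevU_self,
      ← pow_mul, mul_comm n, pow_mul]
    norm_num
  have hlow : ∑ k ∈ range n, ∑ j ∈ range n, (Chebyshev.U ℝ k).coeff j ^ 2 * monomialWeight l j =
      ∑ k ∈ range n, gaussianNormSq l (Chebyshev.U ℝ k) :=
    sum_congr rfl fun k hk => by rw [gaussianNormSq_of_natDegree_lt (by simpa using hk)]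
  have hsum := sum_gaussianNormSq_chebyshevU_le hl hn
  rw [gaussianNormSq_of_natDegree_lt (Nat.lt_succ_iff.mpr hp), sum_range_succ, add_comm]
  gcongr
  refine (sum_coeff_sq_mul_le hp _ (monomialWeight_nonneg hl.le)).trans
    (mul_le_mul_of_nonneg_left ?_ (chebyshevUNormSq_nonneg p))
  rw [sum_range_succ, htop] at hsum
  rw [sum_range_succ, hlow]
  linarith

end GaussianNorm

section LowerBound

open Polynomial

theorem abs_coeff_le_of_forall_abs_eval_le {p : ℝ[X]} {n : ℕ} (hp : p.natDegree ≤ n) {M : ℝ}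
    (hM : ∀ x ∈ Set.Icc (-1 : ℝ) 1, |p.eval x| ≤ M) : |p.coeff n| ≤ M * 2 ^ (n - 1) := by
  have hM0 : 0 ≤ M := (abs_nonneg _).trans (hM 0 (by norm_num))
  rcases hM0.eq_or_lt' with rfl | hM0
  · have hzero : p = 0 := eq_zero_of_infinite_isRoot p <|
      (Set.Icc_infinite (show (-1 : ℝ) < 1 by norm_num)).mono fun x hx =>
        abs_nonpos_iff.mp (hM x hx)
    simp [hzero]
  have hle (r : ℝ[X]) (hr : r.natDegree ≤ n) (hrM : ∀ x ∈ Set.Icc (-1 : ℝ) 1, |r.eval x| ≤ M) :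
      r.coeff n ≤ M * 2 ^ (n - 1) := by
    rw [← inv_mul_le_iff₀ hM0, ← coeff_C_mul]
    refine Chebyshev.coeff_le_of_forall_abs_le_one
      (degree_le_of_natDegree_le ((natDegree_C_mul_le _ _).trans hr)) fun x hx => ?_
    rw [eval_mul, eval_C, abs_mul, abs_of_pos (inv_pos.mpr hM0), inv_mul_le_iff₀ hM0, mul_one]
    exact hrM x hx
  refine abs_le'.mpr ⟨hle p hp hM, ?_⟩
  rw [← coeff_neg]
  exact hle (-p) (by rwa [natDegree_neg]) (by simpa only [eval_neg, abs_neg] using hM)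

theorem quarter_add_mul_exp_sub_one_le {l : ℝ} (hl : 0 ≤ l) :
    1 / 4 + ((1 + l / 4) * Real.exp (l ^ 2 / 16) - 1) ≤ (1 + l) / 2 * Real.exp (l ^ 2 / 16) := by
  suffices (2 - l) * Real.exp (l ^ 2 / 16) ≤ 3 by linarith
  rcases le_total 2 l with h | h
  · linarith [mul_nonneg (sub_nonneg.mpr h) (Real.exp_pos (l ^ 2 / 16)).le]
  have hexp : Real.exp (l ^ 2 / 16) ≤ 3 / 2 := by
    refine le_of_pow_le_pow_left₀ (n := 4) (by norm_num) (by norm_num) ?_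
    calc Real.exp (l ^ 2 / 16) ^ 4 = Real.exp (l ^ 2 / 4) := by
          rw [← Real.exp_nat_mul]
          ring_nf
      _ ≤ Real.exp 1 := Real.exp_le_exp.mpr (by nlinarith)
      _ ≤ (3 / 2) ^ 4 := by linarith [Real.exp_one_lt_d9]
  calc (2 - l) * Real.exp (l ^ 2 / 16) ≤ 2 * (3 / 2) := by
        gcongr
        linarith
    _ = 3 := by norm_num

theorem gaussianNormSq_le_of_forall_abs_eval_le {l : ℝ} (hl : 0 < l) {n : ℕ} (hn : l ≤ n)
    {p : ℝ[X]} (hp : p.natDegree ≤ n) {M : ℝ} (hM : ∀ x ∈ Set.Icc (-1 : ℝ) 1, |p.eval x| ≤ M) :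
    gaussianNormSq l p ≤
      M ^ 2 * (4 ^ n * monomialWeight l n * ((1 + l) / 2 * Real.exp (l ^ 2 / 16))) := by
  have hw := monomialWeight_nonneg hl.le n
  have hlead : p.coeff n ^ 2 ≤ M ^ 2 * (4 ^ n * (1 / 4)) := by
    obtain ⟨m, rfl⟩ := Nat.exists_eq_succ_of_ne_zero (Nat.cast_pos.mp (hl.trans_le hn)).ne'
    calc p.coeff (m + 1) ^ 2 ≤ (M * 2 ^ m) ^ 2 :=
          sq_le_sq.mpr ((abs_coeff_le_of_forall_abs_eval_le hp hM).trans (le_abs_self _))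
      _ = M ^ 2 * (4 ^ (m + 1) * (1 / 4)) := by
          rw [mul_pow, ← pow_mul, mul_comm m, pow_mul, pow_succ]
          ring
  have hexp : 0 ≤ (1 + l / 4) * Real.exp (l ^ 2 / 16) - 1 :=
    sub_nonneg.mpr (one_le_mul_of_one_le_of_one_le (by linarith)
      (Real.one_le_exp (by positivity)))
  calc gaussianNormSq l p
      ≤ p.coeff n ^ 2 * monomialWeight l n + chebyshevUNormSq p *
        (4 ^ n * monomialWeight l n * ((1 + l / 4) * Real.exp (l ^ 2 / 16) - 1)) :=
        gaussianNormSq_le_leadingCoeff_add hl hn hp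
    _ ≤ M ^ 2 * (4 ^ n * (1 / 4)) * monomialWeight l n + M ^ 2 *
        (4 ^ n * monomialWeight l n * ((1 + l / 4) * Real.exp (l ^ 2 / 16) - 1)) := by
        gcongr
        exact chebyshevUNormSq_le_sq hM
    _ = M ^ 2 * (4 ^ n * monomialWeight l n *
        (1 / 4 + ((1 + l / 4) * Real.exp (l ^ 2 / 16) - 1))) := by ring
    _ ≤ M ^ 2 * (4 ^ n * monomialWeight l n * ((1 + l) / 2 * Real.exp (l ^ 2 / 16))) := by
        gcongr
        exact quarter_add_mul_exp_sub_one_le hl.le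

theorem gaussianNormSq_le_integral {l : ℝ} (hl : 0 < l) {n : ℕ} (hn : l ≤ n) {p : ℝ[X]}
    (hp : p.natDegree ≤ n) :
    gaussianNormSq l p ≤ (∫ x in (-1 : ℝ)..1, p.eval x ^ 2) *
      (4 ^ n * monomialWeight l n * ((4 + l) / (2 * Real.pi) * Real.exp (l ^ 2 / 16))) := by
  have hw := monomialWeight_nonneg hl.le n
  calc gaussianNormSq l p ≤ 2 / Real.pi * (∫ x in (-1 : ℝ)..1, p.eval x ^ 2) *
        (4 ^ n * monomialWeight l n * ((1 + l / 4) * Real.exp (l ^ 2 / 16))) := by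
        refine (gaussianNormSq_le_chebyshevUNormSq hl hn hp).trans ?_
        gcongr
        exact chebyshevUNormSq_le_integral p
    _ = _ := by
        field_simp
        ring

variable {ε : ℝ} {n : ℕ}

theorem le_worstCaseError {p : ℝ≥0∞} {A : LinearApprox n} {f : GaussianRKHS ε} (hf0 : f ≠ 0)
    (hf : ∀ k, f (A.point k) = 0) : pNorm p f / ‖f‖ₑ ≤ worstCaseError ε p A := by
  have happly : A.apply f = 0 := by
    ext y
    exact Finset.sum_eq_zero fun k _ => by rw [hf, zero_mul]
  refine le_iSup₂_of_le f hf0 ?_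
  rw [happly, sub_zero]

theorem exists_forall_point_eq_zero_mul_abs_le (hε : 0 < ε) (x : Fin n → I) :
    ∃ f : GaussianRKHS ε, f ≠ 0 ∧ (∀ k, f (x k) = 0) ∧
      ‖f‖ ≤ √(gaussianNormSq (ε ^ 2) (nodePolynomial x)) ∧
      ∀ y : I, Real.exp (-(1 / 2) * ε ^ 2) * |(nodePolynomial x).eval (y : ℝ)| ≤ |f y| := by
  obtain ⟨f, hnorm, hf⟩ := exists_eq_gaussian_mul_polynomial hε (nodePolynomial x)
  refine ⟨f, ?_, fun k => ?_, hnorm, fun y => ?_⟩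
  · rintro rfl
    refine Lagrange.nodal_ne_zero (eq_zero_of_infinite_isRoot (nodePolynomial x) <|
      (Set.Icc_infinite (show (-1 : ℝ) < 1 by norm_num)).mono fun y hy => ?_)
    simpa using (hf ⟨y, hy⟩).symm
  · rw [hf, nodePolynomial, Lagrange.eval_nodal,
      Finset.prod_eq_zero (Finset.mem_univ k) (sub_self _), mul_zero]
  · have hy : (y : ℝ) ^ 2 ≤ 1 := (sq_le_one_iff_abs_le_one _).mpr (abs_le.mpr y.2)
    rw [hf, abs_mul, Real.abs_exp]
    gcongr
    nlinarith [sq_nonneg ε]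

theorem ofReal_mul_exp_le_worstCaseError (hε : 0 < ε) {p : ℝ≥0∞} (hp : p ≠ 0)
    {A : LinearApprox n} {c : ℝ} (hc0 : 0 ≤ c)
    (hc : ENNReal.ofReal (c * √(gaussianNormSq (ε ^ 2) (nodePolynomial A.point))) ≤
      pNorm p fun y => (nodePolynomial A.point).eval (y : ℝ)) :
    ENNReal.ofReal (c * Real.exp (-(1 / 2) * ε ^ 2)) ≤ worstCaseError ε p A := by
  obtain ⟨f, hf0, hzero, hnorm, hf⟩ := exists_forall_point_eq_zero_mul_abs_le hε A.point
  refine le_trans ?_ (le_worstCaseError hf0 hzero)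
  rw [ENNReal.le_div_iff_mul_le (.inl (by simpa using hf0)) (.inl (by simp)),
    ← ofReal_norm, ← ENNReal.ofReal_mul' (norm_nonneg f)]
  calc ENNReal.ofReal (c * Real.exp (-(1 / 2) * ε ^ 2) * ‖f‖)
      ≤ ENNReal.ofReal (Real.exp (-(1 / 2) * ε ^ 2) *
          (c * √(gaussianNormSq (ε ^ 2) (nodePolynomial A.point)))) := by
        rw [mul_comm c, mul_assoc]
        gcongr
    _ ≤ ‖Real.exp (-(1 / 2) * ε ^ 2)‖ₑ *
          pNorm p fun y => (nodePolynomial A.point).eval (y : ℝ) := by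
        rw [ENNReal.ofReal_mul (Real.exp_pos _).le, Real.enorm_of_nonneg (Real.exp_pos _).le]
        gcongr
    _ ≤ pNorm p f := by
        rw [← pNorm_const_smul hp]
        refine pNorm_mono (fun y => ?_) p
        simpa only [Pi.smul_apply, smul_eq_mul, abs_mul, Real.abs_exp] using hf y

/-- The common rate `(ε / 2)^n (n!)^{-1/2}` of all lower bounds. -/
def lowerRate (ε : ℝ) (n : ℕ) : ℝ := (ε / 2) ^ n * (n ! : ℝ) ^ (-(1 / 2) : ℝ)

theorem lowerRate_sq (ε : ℝ) (n : ℕ) :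
    lowerRate ε n ^ 2 = (4 ^ n * monomialWeight (ε ^ 2) n)⁻¹ := by
  rw [lowerRate, monomialWeight, mul_pow, rpow_neg_half_sq (by positivity), ← pow_mul,
    mul_comm n 2, pow_mul, div_pow, div_pow, mul_inv, inv_div]
  norm_num
  ring

theorem mul_lowerRate_mul_sqrt_gaussianNormSq_le (hε : 0 < ε) {q : ℝ[X]} {κ t B b : ℝ}
    (hq : gaussianNormSq (ε ^ 2) q ≤
      B * (4 ^ n * monomialWeight (ε ^ 2) n * (t * Real.exp ((ε ^ 2) ^ 2 / 16))))
    (hb : 0 ≤ b) (h : κ ^ 2 * t * B ≤ b ^ 2) :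
    κ * Real.exp (-(1 / 32) * (ε ^ 2) ^ 2) * lowerRate ε n * √(gaussianNormSq (ε ^ 2) q) ≤ b := by
  have hexp : Real.exp (-(1 / 32) * (ε ^ 2) ^ 2) ^ 2 = (Real.exp ((ε ^ 2) ^ 2 / 16))⁻¹ := by
    rw [← Real.exp_nat_mul, ← Real.exp_neg]
    ring_nf
  have hW : 0 < monomialWeight (ε ^ 2) n := by
    unfold monomialWeight
    positivity
  refine le_of_sq_le_sq (le_trans ?_ h) hb
  rw [mul_pow, mul_pow, mul_pow, hexp, lowerRate_sq,
    Real.sq_sqrt (gaussianNormSq_nonneg (sq_nonneg ε) q)]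
  calc _ ≤ κ ^ 2 * (Real.exp ((ε ^ 2) ^ 2 / 16))⁻¹ * (4 ^ n * monomialWeight (ε ^ 2) n)⁻¹ *
        (B * (4 ^ n * monomialWeight (ε ^ 2) n * (t * Real.exp ((ε ^ 2) ^ 2 / 16)))) := by gcongr
    _ = κ ^ 2 * t * B := by field_simp

theorem natDegree_nodePolynomial (x : Fin n → I) : (nodePolynomial x).natDegree = n := by
  rw [nodePolynomial, Lagrange.natDegree_nodal, Finset.card_fin]

theorem ofReal_cLower_top_le_worstCaseError (hε : 0 < ε) (hn : ε ^ 2 ≤ n) (A : LinearApprox n) :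
    ENNReal.ofReal (√(2 / (1 + ε ^ 2)) * Real.exp (-(1 / 32) * (ε ^ 2) ^ 2) * lowerRate ε n *
      Real.exp (-(1 / 2) * ε ^ 2)) ≤ worstCaseError ε ∞ A := by
  have hrate : 0 ≤ lowerRate ε n := by
    unfold lowerRate
    positivity
  refine ofReal_mul_exp_le_worstCaseError hε ENNReal.top_ne_zero (by positivity) ?_
  set q := nodePolynomial A.point
  obtain ⟨y, hy, hmax⟩ := (isCompact_Icc (a := (-1 : ℝ)) (b := 1)).exists_isMaxOn
    ⟨0, by norm_num⟩ (f := fun x => |q.eval x|) (by fun_prop)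
  calc _ ≤ ENNReal.ofReal |q.eval y| := by
        refine ENNReal.ofReal_le_ofReal (mul_lowerRate_mul_sqrt_gaussianNormSq_le hε
          (gaussianNormSq_le_of_forall_abs_eval_le (by positivity) hn
            (natDegree_nodePolynomial _).le hmax) (abs_nonneg _) (le_of_eq ?_))
        rw [Real.sq_sqrt (by positivity)]
        field_simp
    _ ≤ pNorm ∞ fun y => q.eval (y : ℝ) := by
        rw [pNorm_top, ← Real.enorm_eq_ofReal_abs]
        exact le_iSup (fun y : I => ‖q.eval (y : ℝ)‖ₑ) ⟨y, hy⟩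

theorem pNorm_two_polynomial (q : ℝ[X]) :
    pNorm 2 (fun y => q.eval (y : ℝ)) = ENNReal.ofReal √(∫ x in (-1 : ℝ)..1, q.eval x ^ 2) := by
  rw [pNorm_eq_ofReal_integral two_ne_zero ENNReal.ofNat_ne_top q.continuous, Real.sqrt_eq_rpow]
  simp only [ENNReal.toReal_ofNat, Real.rpow_two, sq_abs]

theorem ofReal_cLower_two_le_worstCaseError (hε : 0 < ε) (hn : ε ^ 2 ≤ n) {p : ℝ≥0∞}
    (hp : 2 ≤ p) (A : LinearApprox n) :
    ENNReal.ofReal (2 * √(2 * Real.pi) / (3 * Real.exp 1 ^ 3 * √(4 + ε ^ 2)) *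
      Real.exp (-(1 / 32) * (ε ^ 2) ^ 2) * lowerRate ε n * Real.exp (-(1 / 2) * ε ^ 2)) ≤
      worstCaseError ε p A := by
  have hrate : 0 ≤ lowerRate ε n := by
    unfold lowerRate
    positivity
  refine ofReal_mul_exp_le_worstCaseError hε (two_pos.trans_le hp).ne' (by positivity) ?_
  set q := nodePolynomial A.point
  set N := ∫ x in (-1 : ℝ)..1, q.eval x ^ 2
  have hN : 0 ≤ N := intervalIntegral.integral_nonneg (by norm_num) fun _ _ => sq_nonneg _
  have hconst : (2 * √(2 * Real.pi) / (3 * Real.exp 1 ^ 3 * √(4 + ε ^ 2))) ^ 2 *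
      ((4 + ε ^ 2) / (2 * Real.pi)) ≤ 1 / 2 := by
    have hexp : 1 ≤ (Real.exp 1 ^ 3) ^ 2 := one_le_pow₀ (one_le_pow₀ (Real.one_le_exp zero_le_one))
    calc _ = 4 / (9 * (Real.exp 1 ^ 3) ^ 2) := by
          rw [div_pow, mul_pow, mul_pow, mul_pow, Real.sq_sqrt (by positivity),
            Real.sq_sqrt (by positivity)]
          field_simp
          norm_num
      _ ≤ 1 / 2 := by
          rw [div_le_div_iff₀ (by positivity) two_pos]
          linarith
  have htwo : ENNReal.ofReal √N ≤ ENNReal.ofReal √2 * pNorm p fun y => q.eval (y : ℝ) := by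
    rw [← pNorm_two_polynomial]
    exact pNorm_two_le_sqrt_two_mul_pNorm hp (q.continuous.comp continuous_subtype_val)
  calc _ ≤ ENNReal.ofReal (√N / √2) := by
        refine ENNReal.ofReal_le_ofReal (mul_lowerRate_mul_sqrt_gaussianNormSq_le hε
          (gaussianNormSq_le_integral (by positivity) hn (natDegree_nodePolynomial _).le)
          (by positivity) ?_)
        rw [div_pow √N, Real.sq_sqrt hN, Real.sq_sqrt zero_le_two]
        linarith [mul_le_mul_of_nonneg_right hconst hN]
    _ ≤ pNorm p fun y => q.eval (y : ℝ) := by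
        rw [ENNReal.ofReal_div_of_pos (by positivity)]
        exact ENNReal.div_le_of_le_mul' htwo

theorem ofReal_cLower_le_worstCaseError (hε : 0 < ε) (hn : ε ^ 2 ≤ n) {p : ℝ≥0∞} (hp : 2 ≤ p)
    (A : LinearApprox n) :
    ENNReal.ofReal (cLower p (ε ^ 2) (Real.exp (-(1 / 2) * ε ^ 2)) * (ε / 2) ^ n *
      (n ! : ℝ) ^ (-(1 / 2) : ℝ)) ≤ worstCaseError ε p A := by
  rcases eq_or_ne p ∞ with rfl | hp'
  · convert! ofReal_cLower_top_le_worstCaseError hε hn A using 2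
    rw [cLower, if_pos rfl, lowerRate]
    ring
  · convert! ofReal_cLower_two_le_worstCaseError hε hn hp A using 2
    rw [cLower, if_neg hp', lowerRate]
    ring

end LowerBound

end GaussApprox

end

theorem theorem1p2_general (ε : ℝ) (hε : 0 < ε) (n : ℕ) (h5 : 5 * ε ^ 2 ≤ n)
    (h9 : 9 ≤ ε ^ 2 * n) :
    (∀ p : ℝ≥0∞, 2 ≤ p →
      (ENNReal.ofReal (GaussApprox.cLower p (ε ^ 2) (Real.exp (-(1 / 2) * ε ^ 2)) *
            (ε / 2) ^ n * (n ! : ℝ) ^ (-(1 / 2) : ℝ))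
          ≤ GaussApprox.minimalError ε p n ∧
        GaussApprox.minimalError ε p n
          ≤ ENNReal.ofReal (2 * √(2 * GaussApprox.cL (ε ^ 2)) * (n : ℝ) ^ (-(1 / 8) : ℝ) *
            Real.exp (ε * √n) * (ε / 2) ^ n * (n ! : ℝ) ^ (-(1 / 2) : ℝ))) ∧
      ∀ x : Fin n → GaussApprox.I, Function.Injective x →
        ∃ A : GaussApprox.LinearApprox n, A.point = x ∧
          ENNReal.ofReal (GaussApprox.cLower p (ε ^ 2) (Real.exp (-(1 / 2) * ε ^ 2)) *
              (ε / 2) ^ n * (n ! : ℝ) ^ (-(1 / 2) : ℝ))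
            ≤ GaussApprox.worstCaseError ε p A ∧
          GaussApprox.worstCaseError ε p A
            ≤ ENNReal.ofReal (√(2 * GaussApprox.cL (ε ^ 2)) *
              (n : ℝ) ^ (-(1 / 8) - (1 / p).toReal : ℝ) *
              Real.exp (ε * √n) * (2 * ε) ^ n * (n ! : ℝ) ^ (-(1 / 2) : ℝ))) ∧
    (∀ c₁ c₂ : ℝ,
      c₁ = √(2 / (1 + ε ^ 2)) * Real.exp (-((1 / 32) * ε ^ 4 + (1 / 2) * ε ^ 2)) →
      c₂ = 2 * √(GaussApprox.cL (ε ^ 2)) →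
      (ENNReal.ofReal (c₁ * (ε / 2) ^ n * (n ! : ℝ) ^ (-(1 / 2) : ℝ))
          ≤ GaussApprox.minimalError ε ∞ n ∧
        GaussApprox.minimalError ε ∞ n
          ≤ ENNReal.ofReal (c₂ * (n : ℝ) ^ (-(1 / 8) : ℝ) * Real.exp (ε * √n) *
            (ε / 2) ^ n * (n ! : ℝ) ^ (-(1 / 2) : ℝ))) ∧
      ∀ x : Fin n → GaussApprox.I, Function.Injective x →
        ∃ A : GaussApprox.LinearApprox n, A.point = x ∧
          ENNReal.ofReal (c₁ * (ε / 2) ^ n * (n ! : ℝ) ^ (-(1 / 2) : ℝ))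
            ≤ GaussApprox.worstCaseError ε ∞ A ∧
          GaussApprox.worstCaseError ε ∞ A
            ≤ ENNReal.ofReal (c₂ / 2 * (n : ℝ) ^ (-(1 / 8) : ℝ) * Real.exp (ε * √n) *
              (2 * ε) ^ n * (n ! : ℝ) ^ (-(1 / 2) : ℝ))) := by
  have hlow (p : ℝ≥0∞) (hp : 2 ≤ p) (A : GaussApprox.LinearApprox n) :=
    GaussApprox.ofReal_cLower_le_worstCaseError hε (by linarith [sq_nonneg ε]) hp A
  refine ⟨fun p hp => ⟨⟨le_iInf (hlow p hp), GaussApprox.minimalError_le hε h5 h9 hp⟩,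
    fun x hx => ?_⟩, ?_⟩
  · obtain ⟨A, hAx, -, hA⟩ := GaussApprox.exists_worstCaseError_le hε h5 h9 hx
    exact ⟨A, hAx, hlow p hp A, hA p hp⟩
  · rintro c₁ _ hc₁ rfl
    have hc₁' : c₁ = GaussApprox.cLower ∞ (ε ^ 2) (Real.exp (-(1 / 2) * ε ^ 2)) := by
      rw [hc₁, GaussApprox.cLower, if_pos rfl, mul_assoc, ← Real.exp_add]
      ring_nf
    rw [hc₁', mul_div_cancel_left₀ _ two_ne_zero]
    refine ⟨⟨le_iInf (hlow ∞ le_top), GaussApprox.minimalError_top_le hε h5 h9⟩, fun x hx => ?_⟩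
    obtain ⟨A, hAx, hA, -⟩ := GaussApprox.exists_worstCaseError_le hε h5 h9 hx
    exact ⟨A, hAx, hlow ∞ le_top A, hA⟩

theorem theorem1p2 (ε : ℝ) (hε : 0 < ε) (n : ℕ) (hn : GaussApprox.mL (ε ^ 2) ≤ (n : ℝ)) :
    -- the bounds for `p ∈ {2, ∞}`
    (∀ p : ℝ≥0∞, p = 2 ∨ p = ∞ →
      (ENNReal.ofReal (GaussApprox.cLower p (ε ^ 2) (Real.exp (-(1 / 2) * ε ^ 2)) *
            (ε / 2) ^ n * (n ! : ℝ) ^ (-(1 / 2) : ℝ))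
          ≤ GaussApprox.minimalError ε p n ∧
        GaussApprox.minimalError ε p n
          ≤ ENNReal.ofReal (2 * √(2 * GaussApprox.cL (ε ^ 2)) * (n : ℝ) ^ (-(1 / 8) : ℝ) *
            Real.exp (ε * √n) * (ε / 2) ^ n * (n ! : ℝ) ^ (-(1 / 2) : ℝ))) ∧
      ∀ x : Fin n → GaussApprox.I, Function.Injective x →
        ∃ A : GaussApprox.LinearApprox n, A.point = x ∧
          ENNReal.ofReal (GaussApprox.cLower p (ε ^ 2) (Real.exp (-(1 / 2) * ε ^ 2)) *
              (ε / 2) ^ n * (n ! : ℝ) ^ (-(1 / 2) : ℝ))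
            ≤ GaussApprox.worstCaseError ε p A ∧
          GaussApprox.worstCaseError ε p A
            ≤ ENNReal.ofReal (√(2 * GaussApprox.cL (ε ^ 2)) *
              (n : ℝ) ^ (-(1 / 8) - (1 / p).toReal : ℝ) *
              Real.exp (ε * √n) * (2 * ε) ^ n * (n ! : ℝ) ^ (-(1 / 2) : ℝ))) ∧
    -- the bounds for `p = ∞` with sharper constants
    (∀ c₁ c₂ : ℝ,
      c₁ = √(2 / (1 + ε ^ 2)) * Real.exp (-((1 / 32) * ε ^ 4 + (1 / 2) * ε ^ 2)) →
      c₂ = 2 * √(GaussApprox.cL (ε ^ 2)) →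
      (ENNReal.ofReal (c₁ * (ε / 2) ^ n * (n ! : ℝ) ^ (-(1 / 2) : ℝ))
          ≤ GaussApprox.minimalError ε ∞ n ∧
        GaussApprox.minimalError ε ∞ n
          ≤ ENNReal.ofReal (c₂ * (n : ℝ) ^ (-(1 / 8) : ℝ) * Real.exp (ε * √n) *
            (ε / 2) ^ n * (n ! : ℝ) ^ (-(1 / 2) : ℝ))) ∧
      ∀ x : Fin n → GaussApprox.I, Function.Injective x →
        ∃ A : GaussApprox.LinearApprox n, A.point = x ∧
          ENNReal.ofReal (c₁ * (ε / 2) ^ n * (n ! : ℝ) ^ (-(1 / 2) : ℝ))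
            ≤ GaussApprox.worstCaseError ε ∞ A ∧
          GaussApprox.worstCaseError ε ∞ A
            ≤ ENNReal.ofReal (c₂ / 2 * (n : ℝ) ^ (-(1 / 8) : ℝ) * Real.exp (ε * √n) *
              (2 * ε) ^ n * (n ! : ℝ) ^ (-(1 / 2) : ℝ))) := by
  obtain ⟨h5, -, h9⟩ := by simpa only [GaussApprox.mL, max_le_iff] using hn
  rw [div_le_iff₀' (by positivity)] at h9
  exact (theorem1p2_general ε hε n h5 h9).imp_left fun h p hp =>
    h p (by rcases hp with rfl | rfl <;> simp)
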